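/- Let $(H,\langle\cdot,\cdot\rangle,\|\cdot\|)$ be a separable complex Hilbert space and let $A:D(A)\subset H\to H$ be a strictly positive selfadjoint operator (i.e. $A$ is selfadjoint and $\langle Au,u\rangle\ge c\|u\|^2$ on $D(A)$ for some $c>0$) with spectral measure $E_A$ on its spectrum $\sigma(A)\subset(0,\infty)$. For a continuous function $\varphi$ on $\sigma(A)$ write $\varphi(A)=\int_{\sigma(A)}\varphi\,dE_A$. Let $f:\sigma(A)\to[0,\infty)$ be continuous and put $$\mathcal Z=\{s\in\sigma(A):\ f(s)=0\}.$$ Let $\mathcal H=D(A^{1/2})\times H$ with the norm $\|(u,v)\|_{\mathcal H}^2=\|A^{1/2}u\|^2+\|v\|^2$, and let $S(t)$, $t\ge 0$, be the strongly continuous semigroup on $\mathcal H$ whose infinitesimal generator is the operator $$\mathbb A(u,v)=(v,\,-Au-f(A)v),\qquad D(\mathbb A)=\{(u,v)\in\mathcal H:\ v\in D(A^{1/2}),\ Au+f(A)v\in H\},$$ where $Au+f(A)v$ is understood in the sense of duality: $Au+f(A)v=h\in H$ means $\langle Aw,u\rangle+\langle f(A)w,v\rangle=\langle w,h\rangle$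 for all $w\in D(A)\cap D(f(A))$. Thus $S(t)$ is the solution semigroup of $\ddot u+Au+f(A)\dot u=0$. Call $S(t)$ stable if $\lim_{t\to\infty}\|S(t)z\|_{\mathcal H}=0$ for every $z\in\mathcal H$. Assume that $A^{-1}$ is a compact operator on $H$. If $S(t)$ is stable, then $\mathcal Z=\emptyset$. Consequently, in this case, $S(t)$ is stable if and only if $\mathcal Z=\emptyset$. -/

import Mathlib

open MeasureTheory Filter Topology
open scoped ENNReal NNReal ComplexConjugate

noncomputable section

namespace DampedWave

/-! ### Integrals against complex measures -/

/-- The integral of a complex function against a complex measure. -/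
def cintegral (μ : ComplexMeasure ℝ) (φ : ℝ → ℂ) : ℂ :=
  VectorMeasure.integral μ φ (ContinuousLinearMap.mul ℝ ℂ)

theorem cintegral_add {μ ν : ComplexMeasure ℝ} {φ : ℝ → ℂ}
    (hμ : μ.Integrable φ) (hν : ν.Integrable φ) :
    cintegral (μ + ν) φ = cintegral μ φ + cintegral ν φ :=
  VectorMeasure.integral_add_vectorMeasure hμ hν

theorem integrable_smul {μ : ComplexMeasure ℝ} {φ : ℝ → ℂ} (hμ : μ.Integrable φ) (c : ℂ) :
    VectorMeasure.Integrable (c • μ) φ := by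
  apply Integrable.mono_measure (Integrable.smul_measure_nnreal hμ (c := ‖c‖₊))
  simp [VectorMeasure.variation_smul]

theorem cintegral_smul {μ : ComplexMeasure ℝ} {φ : ℝ → ℂ} (hμ : μ.Integrable φ) (c : ℂ) :
    cintegral (c • μ) φ = c * cintegral μ φ := by
  have hle : (c • μ).variation ≤ ((‖c‖₊ : ℝ≥0∞)) • μ.variation := by
    simp [VectorMeasure.variation_smul]
  have hT : DominatedFinMeasAdditive μ.variation
      ((c • μ).transpose (ContinuousLinearMap.mul ℝ ℂ))
      (‖c‖ * ‖ContinuousLinearMap.mul ℝ ℂ‖) := by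
    refine ⟨fun s t hs ht _ _ hd => cbmApplyMeasure_union (c • μ)
      (ContinuousLinearMap.mul ℝ ℂ) hs ht hd, fun s hs hsf => ?_⟩
    refine (norm_cbmApplyMeasure_le (c • μ) (ContinuousLinearMap.mul ℝ ℂ) s).trans ?_
    have h1 := VectorMeasure.norm_measure_le_variation hsf.ne
    have h2 : ‖(c • μ) s‖ = ‖c‖ * ‖μ s‖ := by simp
    rw [h2, mul_comm ‖c‖ ‖ContinuousLinearMap.mul ℝ ℂ‖, mul_assoc]
    gcongr
  have h0 : cintegral (c • μ) φ = setToFun μ.variation _ hT φ :=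
    (setToFun_congr_measure_of_integrable _ ENNReal.coe_ne_top hle hT _ φ hμ).symm
  rw [h0]
  unfold cintegral VectorMeasure.integral
  refine Integrable.induction
    (P := fun φ => setToFun μ.variation _ hT φ = c * setToFun μ.variation _
      (dominatedFinMeasAdditive_cbmApplyMeasure μ (ContinuousLinearMap.mul ℝ ℂ)) φ)
    ?_ ?_ ?_ ?_ hμ
  · intro x s hs hsf
    rw [setToFun_indicator_const _ hs hsf.ne, setToFun_indicator_const _ hs hsf.ne]
    change x * (c • μ) s = c * (x * μ s)
    simp
    ring
  · intro f g _ hf hg h1 h2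
    rw [setToFun_add _ hf hg, setToFun_add _ hf hg, h1, h2, mul_add]
  · exact isClosed_eq (continuous_setToFun _) ((continuous_setToFun _).const_mul _)
  · intro f g hfg _ h
    rw [← setToFun_congr_ae _ hfg, ← setToFun_congr_ae _ hfg, h]

/-! ### Spectral measures -/

section Hilbert

variable {H : Type*} [NormedAddCommGroup H] [InnerProductSpace ℂ H] [CompleteSpace H]

/-- A (projection-valued) spectral measure on the Borel sets of the real line.
The value of `proj` on sets that are not Borel is irrelevant. -/
structure SpectralMeasure (H : Type*) [NormedAddCommGroup H] [InnerProductSpace ℂ H]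
    [CompleteSpace H] where
  proj : Set ℝ → H →L[ℂ] H
  isStarProjection : ∀ s, MeasurableSet s → IsStarProjection (proj s)
  proj_empty : proj ∅ = 0
  proj_univ : proj Set.univ = 1
  proj_inter : ∀ s t, MeasurableSet s → MeasurableSet t → proj (s ∩ t) = proj s * proj t
  proj_union : ∀ s t, MeasurableSet s → MeasurableSet t → Disjoint s t →
    proj (s ∪ t) = proj s + proj t
  hasSum_inner : ∀ (u v : H) (s : ℕ → Set ℝ), (∀ n, MeasurableSet (s n)) →
    Pairwise (Function.onFun Disjoint s) →
    HasSum (fun n => inner ℂ v (proj (s n) u)) (inner ℂ v (proj (⋃ n, s n) u))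

namespace SpectralMeasure

variable (E : SpectralMeasure H)

open scoped Classical in
/-- The complex measure `μ_{u,v}(s) = ⟨E(s) u, v⟩` (Mathlib's inner product is linear in its
second argument). -/
def complexMeasure (u v : H) : ComplexMeasure ℝ where
  measureOf' s := if MeasurableSet s then inner ℂ v (E.proj s u) else 0
  empty' := by simp [E.proj_empty]
  not_measurable' s hs := by simp [hs]
  m_iUnion' s hs hd := by
    simp only [hs, if_true, MeasurableSet.iUnion hs]
    exact E.hasSum_inner u v s hs hd

theorem complexMeasure_apply (u v : H) {s : Set ℝ} (hs : MeasurableSet s) :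
    E.complexMeasure u v s = inner ℂ v (E.proj s u) := by
  classical
  exact (if_pos hs : (if MeasurableSet s then inner ℂ v (E.proj s u) else 0) = _)

theorem complexMeasure_add (u u' v : H) :
    E.complexMeasure (u + u') v = E.complexMeasure u v + E.complexMeasure u' v := by
  ext s hs : 1
  simp [complexMeasure_apply, hs]

theorem complexMeasure_smul (c : ℂ) (u v : H) :
    E.complexMeasure (c • u) v = c • E.complexMeasure u v := by
  ext s hs : 1
  simp [complexMeasure_apply, hs]

theorem complexMeasure_zero (v : H) : E.complexMeasure 0 v = 0 := by
  ext s hs : 1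
  simp [complexMeasure_apply, hs]

theorem inner_proj_self (u : H) {s : Set ℝ} (hs : MeasurableSet s) :
    inner ℂ u (E.proj s u) = ((‖E.proj s u‖ ^ 2 : ℝ) : ℂ) := by
  have h := E.isStarProjection s hs
  have hi : E.proj s (E.proj s u) = E.proj s u := by
    have := h.isIdempotentElem
    exact congrArg (fun T : H →L[ℂ] H => T u) this.eq
  have hsa : ContinuousLinearMap.adjoint (E.proj s) = E.proj s := h.isSelfAdjoint
  calc inner ℂ u (E.proj s u) = inner ℂ u (E.proj s (E.proj s u)) := by rw [hi]
    _ = inner ℂ (ContinuousLinearMap.adjoint (E.proj s) u) (E.proj s u) :=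
        (ContinuousLinearMap.adjoint_inner_left _ _ _).symm
    _ = inner ℂ (E.proj s u) (E.proj s u) := by rw [hsa]
    _ = _ := by rw [inner_self_eq_norm_sq_to_K]; norm_cast

/-- `μ_{u,u}` as a positive measure: `μ_{u,u}(s) = ⟨E(s) u, u⟩ = ‖E(s) u‖²`. -/
def diagMeasure (u : H) : Measure ℝ :=
  Measure.ofMeasurable (fun s _ => ENNReal.ofReal (‖E.proj s u‖ ^ 2))
    (by simp [E.proj_empty])
    (by
      intro s hs hd
      have h := E.hasSum_inner u u s hs hd
      simp only [E.inner_proj_self u (hs _), E.inner_proj_self u (MeasurableSet.iUnion hs)] at h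
      have h' : HasSum (fun n => ‖E.proj (s n) u‖ ^ 2) (‖E.proj (⋃ n, s n) u‖ ^ 2) := by
        exact_mod_cast h
      rw [← h'.tsum_eq, ENNReal.ofReal_tsum_of_nonneg (fun n => by positivity) h'.summable])

theorem diagMeasure_apply (u : H) {s : Set ℝ} (hs : MeasurableSet s) :
    E.diagMeasure u s = ENNReal.ofReal (‖E.proj s u‖ ^ 2) :=
  Measure.ofMeasurable_apply s hs

theorem diagMeasure_add_le (u v : H) :
    E.diagMeasure (u + v) ≤ (2 : ℝ≥0∞) • (E.diagMeasure u + E.diagMeasure v) := by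
  refine Measure.le_iff.2 fun s hs => ?_
  rw [Measure.smul_apply, Measure.add_apply, E.diagMeasure_apply _ hs, E.diagMeasure_apply _ hs,
    E.diagMeasure_apply _ hs, ← ENNReal.ofReal_add (by positivity) (by positivity), smul_eq_mul,
    show (2 : ℝ≥0∞) = ENNReal.ofReal 2 by simp, ← ENNReal.ofReal_mul (by norm_num)]
  apply ENNReal.ofReal_le_ofReal
  rw [map_add]
  have := norm_add_le (E.proj s u) (E.proj s v)
  nlinarith [sq_nonneg (‖E.proj s u‖ - ‖E.proj s v‖), norm_nonneg (E.proj s u + E.proj s v),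
    norm_nonneg (E.proj s u), norm_nonneg (E.proj s v)]

theorem diagMeasure_smul (c : ℂ) (u : H) :
    E.diagMeasure (c • u) = ENNReal.ofReal (‖c‖ ^ 2) • E.diagMeasure u := by
  ext s hs
  rw [Measure.smul_apply, E.diagMeasure_apply _ hs, E.diagMeasure_apply _ hs, map_smul, norm_smul,
    mul_pow, ENNReal.ofReal_mul (by positivity), smul_eq_mul]

theorem diagMeasure_zero : E.diagMeasure 0 = 0 := by
  ext s hs
  simp [E.diagMeasure_apply _ hs]

/-- The graph of the operator `∫ φ dE`: the pairs `(u, w)` such that `∫ |φ|² dμ_{u,u} < ∞` and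
`⟨w, v⟩ = ∫ φ dμ_{u,v}` for all `v`. (The integrability of `φ` with respect to `μ_{u,v}` is
automatic for measurable `φ`, by the Cauchy-Schwarz inequality.) -/
def opGraph (φ : ℝ → ℂ) : Submodule ℂ (H × H) where
  carrier := {p | (∫⁻ s, ‖φ s‖ₑ ^ 2 ∂(E.diagMeasure p.1)) < ∞ ∧
    ∀ v : H, (E.complexMeasure p.1 v).Integrable φ ∧
      inner ℂ v p.2 = cintegral (E.complexMeasure p.1 v) φ}
  zero_mem' := by
    refine ⟨by simp [diagMeasure_zero], fun v => ?_⟩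
    simp [complexMeasure_zero, cintegral]
  add_mem' := by
    rintro ⟨u, w⟩ ⟨u', w'⟩ ⟨h1, h2⟩ ⟨h1', h2'⟩
    refine ⟨?_, fun v => ?_⟩
    · refine (lintegral_mono' (E.diagMeasure_add_le u u') le_rfl).trans_lt ?_
      rw [lintegral_smul_measure, lintegral_add_measure]
      exact ENNReal.mul_lt_top (by simp) (ENNReal.add_lt_top.2 ⟨h1, h1'⟩)
    · simp only [Prod.mk_add_mk, complexMeasure_add, inner_add_right]
      refine ⟨(h2 v).1.add_vectorMeasure (h2' v).1, ?_⟩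
      rw [cintegral_add (h2 v).1 (h2' v).1, ← (h2 v).2, ← (h2' v).2]
  smul_mem' := by
    rintro c ⟨u, w⟩ ⟨h1, h2⟩
    refine ⟨?_, fun v => ?_⟩
    · simp only [Prod.smul_mk, diagMeasure_smul]
      rw [lintegral_smul_measure]
      exact ENNReal.mul_lt_top (by simp) h1
    · simp only [Prod.smul_mk, complexMeasure_smul, inner_smul_right]
      refine ⟨integrable_smul (h2 v).1 c, ?_⟩
      rw [cintegral_smul (h2 v).1, ← (h2 v).2]

/-- The operator `∫ φ dE`. -/
def op (φ : ℝ → ℂ) : H →ₗ.[ℂ] H := (E.opGraph φ).toLinearPMap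

/-- `opGraph` is single-valued, hence it is the graph of `op`. -/
theorem op_graph (φ : ℝ → ℂ) : (E.op φ).graph = E.opGraph φ := by
  apply Submodule.toLinearPMap_graph_eq
  rintro ⟨u, w⟩ ⟨-, h⟩ rfl
  have := (h w).2
  simpa [complexMeasure_zero, cintegral] using this

open scoped Classical in
/-- The Dirac spectral measure at the origin. -/
def diracZero (H : Type*) [NormedAddCommGroup H] [InnerProductSpace ℂ H] [CompleteSpace H] :
    SpectralMeasure H where
  proj s := if (0 : ℝ) ∈ s then 1 else 0
  isStarProjection s _ := by
    split_ifs
    · exact IsStarProjection.one _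
    · exact IsStarProjection.zero _
  proj_empty := by simp
  proj_univ := by simp
  proj_inter s t _ _ := by
    by_cases h1 : (0 : ℝ) ∈ s <;> by_cases h2 : (0 : ℝ) ∈ t <;> simp [h1, h2]
  proj_union s t _ _ hd := by
    by_cases h1 : (0 : ℝ) ∈ s <;> by_cases h2 : (0 : ℝ) ∈ t <;> simp [h1, h2]
    exact (Set.disjoint_left.1 hd h1 h2).elim
  hasSum_inner u v s _ hd := by
    by_cases h : ∃ n, (0 : ℝ) ∈ s n
    · obtain ⟨n, hn⟩ := h
      have h0 : (0 : ℝ) ∈ ⋃ n, s n := Set.mem_iUnion.2 ⟨n, hn⟩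
      have key := hasSum_single (f := fun m => inner ℂ v ((if (0 : ℝ) ∈ s m then
        (1 : H →L[ℂ] H) else 0) u)) n (by
          intro m hm
          have : (0 : ℝ) ∉ s m := fun h' => Set.disjoint_left.1 (hd hm) h' hn
          simp [this])
      simpa only [h0, hn, if_true] using key
    · have h0 : (0 : ℝ) ∉ ⋃ n, s n := fun h' => h (Set.mem_iUnion.1 h')
      have h1 : ∀ n, (0 : ℝ) ∉ s n := fun n h' => h ⟨n, h'⟩
      simp [h0, h1, hasSum_zero]

end SpectralMeasure

/-! ### Unbounded operators and their functional calculus -/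

/-- `R` is the inverse of `A - z`, that is, a bounded everywhere defined two-sided inverse of
`A - z : D(A) → H`. -/
def IsResolventAt (A : H →ₗ.[ℂ] H) (z : ℂ) (R : H →L[ℂ] H) : Prop :=
  (∀ y : H, ∃ x : A.domain, (x : H) = R y ∧ A x - z • (x : H) = y) ∧
    ∀ x : A.domain, R (A x - z • (x : H)) = x

/-- The (real) spectrum of `A`. For selfadjoint `A` this is the whole spectrum. -/
def realSpectrum (A : H →ₗ.[ℂ] H) : Set ℝ :=
  {s | ¬ ∃ R : H →L[ℂ] H, IsResolventAt A (s : ℂ) R}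

/-- The inverse of `A` exists and is a compact operator on `H`. -/
def HasCompactInverse (A : H →ₗ.[ℂ] H) : Prop :=
  ∃ R : H →L[ℂ] H, IsResolventAt A 0 R ∧ IsCompactOperator R

/-- `A` is selfadjoint and `⟨A u, u⟩ ≥ c ‖u‖²` for some `c > 0`. -/
def IsStrictlyPositiveSelfAdjoint (A : H →ₗ.[ℂ] H) : Prop :=
  IsSelfAdjoint A ∧ ∃ c : ℝ, 0 < c ∧ ∀ u : A.domain,
    c * ‖(u : H)‖ ^ 2 ≤ (inner ℂ (u : H) (A u)).re

/-- `E` is a spectral measure on `σ(A)` with `⟨A u, v⟩ = ∫ s dμ_{u,v}(s)` for `u ∈ D(A)`, `v ∈ H`.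
By the spectral theorem, a selfadjoint `A` has exactly one such `E` (on Borel sets). -/
def IsSpectralMeasureOf (A : H →ₗ.[ℂ] H) (E : SpectralMeasure H) : Prop :=
  E.proj (realSpectrum A)ᶜ = 0 ∧
    ∀ (u : A.domain) (v : H),
      (E.complexMeasure (u : H) v).Integrable (fun s : ℝ => (s : ℂ)) ∧
        inner ℂ v (A u) = cintegral (E.complexMeasure (u : H) v) (fun s : ℝ => (s : ℂ))

open scoped Classical in
/-- The spectral measure `E_A` of a selfadjoint operator `A`. -/
def spectralMeasure (A : H →ₗ.[ℂ] H) : SpectralMeasure H :=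
  if h : ∃ E : SpectralMeasure H, IsSpectralMeasureOf A E then h.choose
  else SpectralMeasure.diracZero H

/-- The operator `φ(A) = ∫_{σ(A)} φ(s) dE_A(s)`. Only the values of `φ` on `σ(A)` matter. -/
def funCalc (A : H →ₗ.[ℂ] H) (φ : ℝ → ℂ) : H →ₗ.[ℂ] H :=
  (spectralMeasure A).op ((realSpectrum A).indicator φ)

/-- The square root `A^{1/2}`. -/
def sqrtOp (A : H →ₗ.[ℂ] H) : H →ₗ.[ℂ] H :=
  funCalc A (fun s => ((Real.sqrt s : ℝ) : ℂ))

/-- The damping operator `f(A)`. -/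
def dampOp (A : H →ₗ.[ℂ] H) (f : ℝ → ℝ) : H →ₗ.[ℂ] H :=
  funCalc A (fun s => (f s : ℂ))

/-! ### The phase space -/

/-- The space `H¹ = D(A^{1/2})` with the norm `‖u‖₁ = ‖A^{1/2} u‖`. -/
def H1 (A : H →ₗ.[ℂ] H) : Type _ := (sqrtOp A).domain

instance (A : H →ₗ.[ℂ] H) : AddCommGroup (H1 A) :=
  inferInstanceAs (AddCommGroup (sqrtOp A).domain)

instance (A : H →ₗ.[ℂ] H) : Module ℂ (H1 A) :=
  inferInstanceAs (Module ℂ (sqrtOp A).domain)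

/-- The inclusion of `H¹` into `H`. -/
def H1.incl (A : H →ₗ.[ℂ] H) : H1 A →ₗ[ℂ] H := (sqrtOp A).domain.subtype

/-- `A^{1/2}` as a linear map from `H¹` to `H`. -/
def H1.sqrtMap (A : H →ₗ.[ℂ] H) : H1 A →ₗ[ℂ] H := (sqrtOp A).toFun

instance (A : H →ₗ.[ℂ] H) : SeminormedAddCommGroup (H1 A) :=
  SeminormedAddCommGroup.induced (H1 A) H (H1.sqrtMap A)

instance (A : H →ₗ.[ℂ] H) : NormedSpace ℂ (H1 A) :=
  NormedSpace.induced ℂ (H1 A) H (H1.sqrtMap A)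

theorem H1.norm_def (A : H →ₗ.[ℂ] H) (u : H1 A) : ‖u‖ = ‖H1.sqrtMap A u‖ := rfl

/-- The phase space `H¹ × H` with the norm `‖(u, v)‖² = ‖A^{1/2} u‖² + ‖v‖²`. For strictly positive
selfadjoint `A` the operator `A^{1/2}` is injective, and this is a Hilbert norm. -/
abbrev PhaseSpace (A : H →ₗ.[ℂ] H) : Type _ := WithLp 2 (H1 A × H)

/-- The graph of the operator `(u, v) ↦ (v, - A u - f(A) v)` on `H¹ × H`, whose domain consists of
the `(u, v)` with `v ∈ H¹` and `A u + f(A) v ∈ H`. Here `A u + f(A) v` is understood by duality,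
as the functional `w ↦ ⟨A w, u⟩ + ⟨f(A) w, v⟩` on `D(A) ∩ D(f(A))`, and it lies in `H` if it is
`w ↦ ⟨w, h⟩` for some `h ∈ H`. -/
def waveGraph (A : H →ₗ.[ℂ] H) (f : ℝ → ℝ) : Set (PhaseSpace A × PhaseSpace A) :=
  {p | H1.incl A p.2.fst = p.1.snd ∧
    ∀ (w : A.domain) (w' : (dampOp A f).domain), (w : H) = (w' : H) →
      inner ℂ (A w) (H1.incl A p.1.fst) + inner ℂ (dampOp A f w') p.1.snd =
        inner ℂ (w : H) (-p.2.snd)}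

/-- The zero-set of `f` on the spectrum of `A`. -/
def zeroSet (A : H →ₗ.[ℂ] H) (f : ℝ → ℝ) : Set ℝ :=
  {s | s ∈ realSpectrum A ∧ f s = 0}

end Hilbert

/-! ### Strongly continuous semigroups -/

/-- A strongly continuous semigroup `(S(t))_{t ≥ 0}` of bounded linear operators. The values at
negative times are irrelevant. -/
structure C0Semigroup (X : Type*) [SeminormedAddCommGroup X] [NormedSpace ℂ X] where
  toFun : ℝ → X →L[ℂ] X
  zero : toFun 0 = ContinuousLinearMap.id ℂ X
  add : ∀ s t : ℝ, 0 ≤ s → 0 ≤ t → toFun (s + t) = (toFun s).comp (toFun t)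
  tendsto : ∀ x : X, Tendsto (fun t => toFun t x) (𝓝[>] 0) (𝓝 x)

namespace C0Semigroup

variable {X : Type*} [SeminormedAddCommGroup X] [NormedSpace ℂ X] (S : C0Semigroup X)

/-- The graph of the infinitesimal generator. -/
def generatorGraph : Set (X × X) :=
  {p | Tendsto (fun t : ℝ => ((t⁻¹ : ℝ) : ℂ) • (S.toFun t p.1 - p.1)) (𝓝[>] 0) (𝓝 p.2)}

/-- Every trajectory tends to zero in norm. -/
def IsStable : Prop := ∀ x : X, Tendsto (fun t => ‖S.toFun t x‖) atTop (𝓝 0)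

end C0Semigroup

end DampedWave

end

namespace DampedWave

/-! ### Diagonalization of an operator with compact inverse. -/

section EigenBasis

universe u

variable {H : Type u} [NormedAddCommGroup H] [InnerProductSpace ℂ H]

/-! Since `A⁻¹` is compact and selfadjoint, `H` has a Hilbert basis of eigenvectors `b i` of `A`,
and `σ(A)` is exactly the set of eigenvalues `lam i` (`exists_isEigenbasis`). Every spectral measure
of `A` is diagonal in this basis, so `φ(A)` multiplies the `i`-th coefficient by `φ (lam i)`
(`IsEigenbasis.mem_funCalc_graph_iff`). The equation therefore splits into scalar oscillators `a'' +
f(lam i) a' + lam i a = 0`. That the abstract semigroup, known only through its generator, really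
acts this way on each mode follows from uniqueness for a linear ODE
(`C0Semigroup.apply_eq_of_generator`, `IsEigenbasis.exists_mode_evolution`).

If `f` vanishes at a point of `σ(A)`, that point is an eigenvalue, and its mode conserves energy, so
`S` is not stable. It is here that compactness is decisive: a zero of `f` in the continuous spectrum
would carry no mode.

Conversely, if `f > 0` on `σ(A)`, every mode decays by a Lyapunov estimate
(`IsOscillator.tendsto_energy`). The rates need not be uniform in `i`, but finite sums of modes are
dense and the semigroup is contractive, which gives stability for all data. -/

theorem _root_.Orthonormal.countable [TopologicalSpace.SeparableSpace H] {ι : Type*} {b : ι → H}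
    (hb : Orthonormal ℂ b) : Countable ι := by
  -- Distinct orthonormal vectors have distance `√2 > 1`, and a separable space contains only
  -- countably many disjoint nonempty open sets.
  have hd : Pairwise (Function.onFun Disjoint fun i => Metric.ball (b i) (1 / 2)) := by
    intro i j hij
    apply Metric.ball_disjoint_ball
    have h := norm_sub_sq (𝕜 := ℂ) (b i) (b j)
    rw [hb.2 hij, hb.1, hb.1, map_zero] at h
    rw [dist_eq_norm]
    nlinarith [norm_nonneg (b i - b j)]
  exact hd.countable_of_isOpen_disjoint (fun _ => Metric.isOpen_ball)
    fun i => ⟨b i, Metric.mem_ball_self (by norm_num)⟩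

theorem inner_basis_self {ι : Type*} (b : HilbertBasis ι ℂ H) (i : ι) :
    inner ℂ (b i) (b i) = 1 := by
  rw [inner_self_eq_norm_sq_to_K, b.orthonormal.1 i]
  norm_num

theorem eq_of_inner_basis {ι : Type*} (b : HilbertBasis ι ℂ H) {x y : H}
    (h : ∀ i, inner ℂ (b i) x = inner ℂ (b i) y) : x = y := by
  apply b.repr.injective
  ext i
  simpa [b.repr_apply_apply] using h i

variable [CompleteSpace H]

/-- A compact selfadjoint operator has a Hilbert basis of eigenvectors. -/
theorem exists_hilbertBasis_eigenvectors {R : H →L[ℂ] H} (hR : IsCompactOperator R)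
    (hs : (R : H →ₗ[ℂ] H).IsSymmetric) :
    ∃ (ι : Type u) (b : HilbertBasis ι ℂ H) (μ : ι → ℂ), ∀ i, R (b i) = μ i • b i := by
  let G : ℂ → Submodule ℂ H := fun μ => Module.End.eigenspace (R : Module.End ℂ H) μ
  have hc : ∀ μ, CompleteSpace (G μ) := fun μ => by
    apply IsClosed.completeSpace_coe (hs := ?_)
    have : (G μ : Set H) = {x | R x = μ • x} := by
      ext x
      exact Module.End.mem_eigenspace_iff
    rw [this]
    exact isClosed_eq R.continuous (continuous_const_smul μ)
  -- Here `μ` runs over all of `ℂ`: where it is not an eigenvalue, the eigenspace is zero and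
  -- contributes no vectors.
  choose w c hcw using fun μ => exists_hilbertBasis ℂ (G μ)
  have hon := hs.orthogonalFamily_eigenspaces.orthonormal_sigma_orthonormal
    (v_family := fun μ => c μ) (fun μ => (c μ).orthonormal)
  refine ⟨Σ μ, w μ, HilbertBasis.mkOfOrthogonalEqBot hon ?_, fun i => i.1, fun i => ?_⟩
  · rw [eq_bot_iff, ← R.orthogonalComplement_iSup_eigenspaces_eq_bot hR hs,
      ← Submodule.iInf_orthogonal]
    intro x hx
    rw [Submodule.mem_iInf]
    intro μ v hv
    have h0 : ∀ y ∈ closure (Submodule.span ℂ (Set.range (c μ)) : Set (G μ)),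
        inner ℂ (y : H) x = 0 := by
      intro y hy
      refine closure_minimal (t := {y : G μ | inner ℂ (y : H) x = 0}) ?_
        (isClosed_eq (by fun_prop) continuous_const) hy
      intro y hy
      have hy' : (y : H) ∈ Submodule.map (G μ).subtype (Submodule.span ℂ (Set.range (c μ))) :=
        ⟨y, hy, rfl⟩
      rw [Submodule.map_span] at hy'
      refine hx _ (Submodule.span_mono ?_ hy')
      rintro _ ⟨_, ⟨j, rfl⟩, rfl⟩
      exact ⟨⟨μ, j⟩, rfl⟩
    refine h0 ⟨v, hv⟩ ?_
    rw [← Submodule.topologicalClosure_coe, (c μ).dense_span]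
    trivial
  · rw [HilbertBasis.coe_mkOfOrthogonalEqBot]
    exact Module.End.mem_eigenspace_iff.1 (c i.1 i.2).2

/-- A Hilbert basis `b` consisting of eigenvectors of `A`, with the eigenvalues `lam`, which
are bounded below by a positive constant and exhaust the spectrum. -/
structure IsEigenbasis (A : H →ₗ.[ℂ] H) {ι : Type*} (b : HilbertBasis ι ℂ H) (lam : ι → ℝ) :
    Prop where
  mem_graph : ∀ i, (b i, (lam i : ℂ) • b i) ∈ A.graph
  inner_apply : ∀ (i) (u : A.domain), inner ℂ (b i) (A u) = lam i * inner ℂ (b i) (u : H)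
  mem_domain : ∀ u w : H, (∀ i, inner ℂ (b i) w = lam i * inner ℂ (b i) u) → (u, w) ∈ A.graph
  exists_le : ∃ c, 0 < c ∧ ∀ i, c ≤ lam i
  realSpectrum_eq : realSpectrum A = Set.range lam

omit [CompleteSpace H] in
theorem IsEigenbasis.pos {A : H →ₗ.[ℂ] H} {ι : Type*} {b : HilbertBasis ι ℂ H} {lam : ι → ℝ}
    (hb : IsEigenbasis A b lam) (i : ι) : 0 < lam i := by
  obtain ⟨c, hc, h⟩ := hb.exists_le
  exact hc.trans_le (h i)

theorem inner_apply_left {A : H →ₗ.[ℂ] H} (hA : IsSelfAdjoint A) (u v : A.domain) :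
    inner ℂ (A u) (v : H) = inner ℂ (u : H) (A v) := by
  have h := LinearPMap.adjoint_isFormalAdjoint hA.dense_domain
  rw [LinearPMap.isSelfAdjoint_def.1 hA] at h
  exact h u v

theorem exists_isEigenbasis {A : H →ₗ.[ℂ] H} (hA : IsStrictlyPositiveSelfAdjoint A)
    (hcomp : HasCompactInverse A) :
    ∃ (ι : Type u) (b : HilbertBasis ι ℂ H) (lam : ι → ℝ), IsEigenbasis A b lam := by
  obtain ⟨hsa, c, hc, hpos⟩ := hA
  obtain ⟨R, ⟨hR1, hR2⟩, hR⟩ := hcomp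
  have hR1' : ∀ y : H, ∃ x : A.domain, (x : H) = R y ∧ A x = y := by
    intro y
    obtain ⟨x, hx, hy⟩ := hR1 y
    exact ⟨x, hx, by simpa using hy⟩
  have hR2' : ∀ x : A.domain, R (A x) = x := fun x => by simpa using hR2 x
  have hs : (R : H →ₗ[ℂ] H).IsSymmetric := by
    intro x y
    obtain ⟨x', hx, rfl⟩ := hR1' x
    obtain ⟨y', hy, rfl⟩ := hR1' y
    simp only [ContinuousLinearMap.coe_coe, hR2']
    exact (inner_apply_left hsa x' y').symm
  obtain ⟨ι, b, μ, hμ⟩ := exists_hilbertBasis_eigenvectors hR hs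
  -- `R` is injective, being an inverse; hence `1 / μ i` makes sense and will be the eigenvalue of
  -- `A`.
  have hμ0 : ∀ i, μ i ≠ 0 := by
    intro i h0
    obtain ⟨x, hx, hy⟩ := hR1' (b i)
    rw [hμ, h0, zero_smul] at hx
    have : x = 0 := Subtype.ext hx
    rw [this, LinearPMap.map_zero] at hy
    exact b.orthonormal.ne_zero i hy.symm
  have hreal : ∀ i, conj (μ i) = μ i := by
    intro i
    have h := hs (b i) (b i)
    simp only [ContinuousLinearMap.coe_coe, hμ, inner_smul_left, inner_smul_right] at h
    have h1 := inner_basis_self b i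
    rwa [h1, mul_one, mul_one] at h
  have hre : ∀ i, (((μ i).re : ℝ) : ℂ) = μ i := fun i => Complex.conj_eq_iff_re.1 (hreal i)
  have hgr : ∀ i, (b i, (((μ i).re⁻¹ : ℝ) : ℂ) • b i) ∈ A.graph := by
    intro i
    obtain ⟨x, hx, hy⟩ := hR1' ((μ i)⁻¹ • b i)
    rw [map_smul, hμ, inv_smul_smul₀ (hμ0 i)] at hx
    rw [LinearPMap.mem_graph_iff]
    refine ⟨x, hx, ?_⟩
    rw [hy]
    simp [hre]
  have hin : ∀ (i) (u : A.domain), inner ℂ (b i) (A u) =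
      (((μ i).re⁻¹ : ℝ) : ℂ) * inner ℂ (b i) (u : H) := by
    intro i u
    obtain ⟨x, hx, hy⟩ := (LinearPMap.mem_graph_iff _).1 (hgr i)
    simp only at hx hy
    rw [← hx, ← inner_apply_left hsa x u, hy, hx, inner_smul_left, Complex.conj_ofReal]
  have hRb : ∀ (i) (u : H), inner ℂ (b i) (R u) = μ i * inner ℂ (b i) u := by
    intro i u
    have := hs (b i) u
    simp only [ContinuousLinearMap.coe_coe, hμ, inner_smul_left, hreal] at this
    exact this.symm
  have hext := fun x y : H => eq_of_inner_basis b (x := x) (y := y)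
  have hsp : realSpectrum A = Set.range fun i => (μ i).re⁻¹ := by
    ext s
    constructor
    · intro hs'
      have hs0 : (s : ℂ) ≠ 0 := by
        intro h0
        exact hs' ⟨R, by rw [h0]; exact ⟨hR1, hR2⟩⟩
      by_contra hne
      have hne' : ∀ i, μ i ≠ (s : ℂ)⁻¹ := by
        intro i hi
        refine hne ⟨i, ?_⟩
        simp only [hi]
        rw [← Complex.ofReal_inv, Complex.ofReal_re, inv_inv]
      -- Fredholm alternative for `R` at `s⁻¹`. An eigenvector would be orthogonal to every `b i`;
      -- otherwise, with `T = (s⁻¹ - R)⁻¹`, the operator `s⁻¹ R T` inverts `A - s`.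
      rcases hR.hasEigenvalue_or_mem_resolventSet (inv_ne_zero hs0) with h | h
      · obtain ⟨v, hv, hv0⟩ := h.exists_hasEigenvector
        refine hv0 (hext v 0 fun i => ?_)
        have h1 := hRb i v
        have h2 : R v = (s : ℂ)⁻¹ • v := Module.End.mem_eigenspace_iff.1 hv
        rw [h2, inner_smul_right] at h1
        rw [inner_zero_right]
        have : ((s : ℂ)⁻¹ - μ i) * inner ℂ (b i) v = 0 := by rw [sub_mul, h1, sub_self]
        exact (mul_eq_zero.1 this).resolve_left (sub_ne_zero.2 (hne' i).symm)
      · apply hs'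
        obtain ⟨Q, hQ⟩ := spectrum.mem_resolventSet_iff.1 h
        set T : H →L[ℂ] H := (↑(Q⁻¹) : H →L[ℂ] H)
        have e1 : ∀ y, (s : ℂ)⁻¹ • T y - R (T y) = y := by
          intro y
          have : (Q : H →L[ℂ] H) * T = 1 := Q.mul_inv
          rw [hQ] at this
          have := congrArg (fun F : H →L[ℂ] H => F y) this
          simpa [Algebra.algebraMap_eq_smul_one] using this
        have e2 : ∀ y, T ((s : ℂ)⁻¹ • y - R y) = y := by
          intro y
          have : T * (Q : H →L[ℂ] H) = 1 := Q.inv_mul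
          rw [hQ] at this
          have := congrArg (fun F : H →L[ℂ] H => F y) this
          simpa [Algebra.algebraMap_eq_smul_one] using this
        refine ⟨(s : ℂ)⁻¹ • (R * T), fun y => ?_, fun x => ?_⟩
        · obtain ⟨x, hx, hy⟩ := hR1' ((s : ℂ)⁻¹ • T y)
          refine ⟨x, by simp [hx], ?_⟩
          rw [hy, hx, map_smul, smul_inv_smul₀ hs0, e1]
        · have hcomm : ∀ y, R (T y) = T (R y) := by
            intro y
            rw [← e2 (R (T y)), ← map_smul, ← map_sub, e1]
          have h3 := e2 (x : H)
          rw [smul_apply, mul_apply_eq_comp, hcomm, map_sub,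
            hR2', map_smul, ← map_smul]
          rw [smul_sub, inv_smul_smul₀ hs0, h3]
    · rintro ⟨i, rfl⟩ ⟨Q, -, hQ⟩
      obtain ⟨x, hx, hy⟩ := (LinearPMap.mem_graph_iff _).1 (hgr i)
      have := hQ x
      simp only at hx hy
      rw [hy, hx, sub_self, map_zero] at this
      exact b.orthonormal.ne_zero i this.symm
  refine ⟨ι, b, fun i => (μ i).re⁻¹, hgr, hin, ?_, ?_, hsp⟩
  · intro u w h
    obtain ⟨x, hx, hy⟩ := hR1' w
    rw [LinearPMap.mem_graph_iff]
    refine ⟨x, ?_, hy⟩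
    refine hext _ _ fun i => ?_
    rw [hx, hRb, h, ← hre i, ← mul_assoc]
    simp [hre, hμ0]
  · refine ⟨c, hc, fun i => ?_⟩
    obtain ⟨x, hx, hy⟩ := (LinearPMap.mem_graph_iff _).1 (hgr i)
    have := hpos x
    simp only at hx hy
    rw [hy, hx, inner_smul_right] at this
    have h1 := inner_basis_self b i
    rw [h1, mul_one, Complex.ofReal_re] at this
    have hn : ‖b i‖ = 1 := b.orthonormal.1 i
    rw [hn] at this
    linarith

end EigenBasis

end DampedWave

namespace DampedWave

/-! ### Integration against purely atomic complex measures. -/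

section DiscreteMeasure

variable {ι : Type*}

/-- The measure `∑ |c i| δ_{lam i}`. -/
noncomputable def atomicMeasure (c : ι → ℂ) (lam : ι → ℝ) : Measure ℝ :=
  Measure.sum fun i => ‖c i‖ₑ • Measure.dirac (lam i)

theorem lintegral_atomicMeasure (c : ι → ℂ) (lam : ι → ℝ) (g : ℝ → ℝ≥0∞) :
    ∫⁻ s, g s ∂(atomicMeasure c lam) = ∑' i, ‖c i‖ₑ * g (lam i) := by
  simp [atomicMeasure, lintegral_sum_measure, lintegral_smul_measure]

theorem atomicMeasure_apply (c : ι → ℂ) (lam : ι → ℝ) {s : Set ℝ} (hs : MeasurableSet s) :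
    atomicMeasure c lam s = ∑' i, ‖s.indicator 1 (lam i) * c i‖ₑ := by
  rw [atomicMeasure, Measure.sum_apply _ hs]
  refine tsum_congr fun i => ?_
  by_cases h : lam i ∈ s <;> simp [h, Measure.dirac_apply]

theorem summable_of_tsum_enorm {a : ι → ℂ} (h : ∑' i, ‖a i‖ₑ < ∞) : Summable a := by
  have h1 : Summable fun i => ‖a i‖₊ := ENNReal.tsum_coe_ne_top_iff_summable.1 h.ne
  exact Summable.of_nnnorm h1

theorem tsum_enorm_lt_top {a : ι → ℂ} (h : Summable a) : ∑' i, ‖a i‖ₑ < ∞ := by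
  have h1 : Summable fun i => ‖a i‖₊ := by
    rw [← NNReal.summable_coe]
    exact h.norm
  exact (ENNReal.tsum_coe_ne_top_iff_summable.2 h1).lt_top

/-- Every function is a.e. strongly measurable for a countable sum of point masses, so no
measurability of `φ` is required. -/
theorem integrable_atomicMeasure [Countable ι] {c : ι → ℂ} {lam : ι → ℝ} {φ : ℝ → ℂ} :
    Integrable φ (atomicMeasure c lam) ↔ Summable fun i => c i * φ (lam i) := by
  have hm : AEStronglyMeasurable φ (atomicMeasure c lam) :=
    aestronglyMeasurable_sum_measure_iff.2 fun i =>
      (aestronglyMeasurable_dirac (a := lam i)).smul_measure _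
  have h : ∫⁻ s, ‖φ s‖ₑ ∂(atomicMeasure c lam) = ∑' i, ‖c i * φ (lam i)‖ₑ := by
    simp [lintegral_atomicMeasure, enorm_mul]
  refine ⟨fun hi => summable_of_tsum_enorm ?_, fun hi => ⟨hm, ?_⟩⟩
  · rw [← h]
    exact hi.2
  · rw [HasFiniteIntegral, h]
    exact tsum_enorm_lt_top hi

/-- The sum is 1-Lipschitz in the `L¹` norm. This supplies the closedness step when the integral
formula is extended from indicators to integrable functions. -/
theorem continuous_tsum_atomicMeasure [Countable ι] (c : ι → ℂ) (lam : ι → ℝ) :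
    Continuous fun φ : Lp ℂ 1 (atomicMeasure c lam) => ∑' i, c i * φ (lam i) := by
  apply LipschitzWith.continuous (K := 1)
  intro φ ψ
  have h1 := integrable_atomicMeasure.1 (L1.integrable_coeFn φ)
  have h2 := integrable_atomicMeasure.1 (L1.integrable_coeFn ψ)
  rw [L1.edist_def, lintegral_atomicMeasure, ENNReal.coe_one, one_mul, edist_eq_enorm_sub,
    ← h1.tsum_sub h2]
  refine enorm_tsum_le_tsum_enorm.trans (le_of_eq (tsum_congr fun i => ?_))
  rw [← mul_sub, enorm_mul, edist_eq_enorm_sub]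

/-- Integration against the complex measure `∑ c i δ_{lam i}`. -/
theorem cintegral_of_hasSum [Countable ι] {μ : ComplexMeasure ℝ} {c : ι → ℂ} {lam : ι → ℝ}
    (hc : Summable c)
    (hμ : ∀ s, MeasurableSet s → HasSum (fun i => s.indicator 1 (lam i) * c i) (μ s))
    {φ : ℝ → ℂ} (hφ : Summable fun i => c i * φ (lam i)) :
    μ.Integrable φ ∧ cintegral μ φ = ∑' i, c i * φ (lam i) := by
  set M := atomicMeasure c lam
  -- Only an inequality holds in general: `lam` may repeat values, and the coefficients at one point
  -- may cancel.
  have hle : μ.variation ≤ M := VectorMeasure.variation_le_of_forall_enorm_le fun s hs => by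
    rw [← (hμ s hs).tsum_eq, atomicMeasure_apply _ _ hs]
    exact enorm_tsum_le_tsum_enorm
  have hfin : ∀ s, M s ≠ ∞ := by
    intro s
    refine ((measure_mono (Set.subset_univ s)).trans_lt ?_).ne
    rw [atomicMeasure_apply _ _ MeasurableSet.univ]
    simpa using tsum_enorm_lt_top hc
  have hM : Integrable φ M := integrable_atomicMeasure.2 hφ
  refine ⟨hM.mono_measure hle, ?_⟩
  have hT : DominatedFinMeasAdditive M
      (μ.transpose (ContinuousLinearMap.mul ℝ ℂ)) ‖ContinuousLinearMap.mul ℝ ℂ‖ := by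
    refine ⟨fun s t hs ht _ _ hd => cbmApplyMeasure_union μ
      (ContinuousLinearMap.mul ℝ ℂ) hs ht hd, fun s hs hsf => ?_⟩
    refine (norm_cbmApplyMeasure_le μ (ContinuousLinearMap.mul ℝ ℂ) s).trans ?_
    gcongr
    exact (VectorMeasure.norm_measure_le_variation ((hle s).trans_lt hsf).ne).trans
      (ENNReal.toReal_mono hsf.ne (hle s))
  have h0 : cintegral μ φ = setToFun M _ hT φ :=
    (setToFun_congr_measure_of_integrable 1 ENNReal.one_ne_top (by simpa using hle)
      hT _ φ hM).symm
  rw [h0]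
  refine Integrable.induction
    (P := fun φ => setToFun M _ hT φ = ∑' i, c i * φ (lam i)) ?_ ?_ ?_ ?_ hM
  · intro x s hs hsf
    rw [setToFun_indicator_const _ hs hsf.ne]
    change x * μ s = _
    rw [← (hμ s hs).tsum_eq, ← tsum_mul_left]
    refine tsum_congr fun i => ?_
    by_cases h : lam i ∈ s <;> simp [h, mul_comm]
  · intro f g _ hf hg h1 h2
    rw [setToFun_add _ hf hg, h1, h2, ← (integrable_atomicMeasure.1 hf).tsum_add
      (integrable_atomicMeasure.1 hg)]
    simp [mul_add]
  · exact isClosed_eq (continuous_setToFun _) (continuous_tsum_atomicMeasure c lam)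
  · intro f g hfg _ h
    rw [← setToFun_congr_ae _ hfg, h]
    refine tsum_congr fun i => ?_
    -- A point `lam i` with `c i ≠ 0` has positive mass, so functions equal a.e. agree there.
    by_cases hi : c i = 0
    · simp [hi]
    · have h2 : M {s | ¬ f s = g s} = 0 := hfg
      have h3 : Measure.dirac (lam i) {s | ¬ f s = g s} = 0 := by
        have h4 := (Measure.le_sum (fun i => ‖c i‖ₑ • Measure.dirac (lam i)) i
          {s | ¬ f s = g s}).trans h2.le
        simpa [hi] using h4
      rw [Measure.dirac_apply] at h3
      by_cases h5 : f (lam i) = g (lam i)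
      · rw [h5]
      · simp [Set.indicator, h5] at h3

end DiscreteMeasure

end DampedWave

namespace DampedWave

/-! ### The spectral measure and functional calculus in an eigenbasis. -/

section SpectralMeasure

variable {H : Type*} [NormedAddCommGroup H] [InnerProductSpace ℂ H]
  {ι : Type*} {b : HilbertBasis ι ℂ H} {lam : ι → ℝ}

theorem ext_basis (b : HilbertBasis ι ℂ H) {S T : H →L[ℂ] H} (h : ∀ i, S (b i) = T (b i)) :
    S = T := by
  refine ContinuousLinearMap.ext_on (s := Set.range b) ?_ ?_
  · rw [dense_iff_closure_eq, ← Submodule.topologicalClosure_coe, b.dense_span]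
    rfl
  · rintro _ ⟨i, rfl⟩
    exact h i

theorem summable_inner_mul (b : HilbertBasis ι ℂ H) (u v : H) :
    Summable fun i => inner ℂ v (b i) * inner ℂ (b i) u :=
  b.summable_inner_mul_inner v u

variable [CompleteSpace H]

/-- The spectral subspace spanned by the basis vectors with `lam i ∈ s`. -/
def spectralSubspace (b : HilbertBasis ι ℂ H) (lam : ι → ℝ) (s : Set ℝ) : Submodule ℂ H :=
  (Submodule.span ℂ (b '' {i | lam i ∈ s})).topologicalClosure

instance (s : Set ℝ) : CompleteSpace (spectralSubspace b lam s) :=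
  (Submodule.isClosed_topologicalClosure _).completeSpace_coe

/-- The projection onto the closed span of the basis vectors with `lam i ∈ s`. -/
noncomputable def spectralProj (b : HilbertBasis ι ℂ H) (lam : ι → ℝ) (s : Set ℝ) : H →L[ℂ] H :=
  (spectralSubspace b lam s).starProjection

theorem spectralProj_of_mem {s : Set ℝ} {i : ι} (h : lam i ∈ s) :
    spectralProj b lam s (b i) = b i := by
  rw [spectralProj, Submodule.starProjection_eq_self_iff]
  exact Submodule.le_topologicalClosure _ (Submodule.subset_span ⟨i, h, rfl⟩)

theorem spectralProj_of_notMem {s : Set ℝ} {i : ι} (h : lam i ∉ s) :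
    spectralProj b lam s (b i) = 0 := by
  rw [spectralProj, Submodule.starProjection_apply_eq_zero_iff, spectralSubspace,
    Submodule.orthogonal_closure, Submodule.mem_orthogonal]
  intro u hu
  induction hu using Submodule.span_induction with
  | mem x hx =>
    obtain ⟨j, hj, rfl⟩ := hx
    refine b.orthonormal.2 fun hij => h ?_
    rw [← hij]
    exact hj
  | zero => simp
  | add x y _ _ hx hy => rw [inner_add_left, hx, hy, add_zero]
  | smul c x _ hx => rw [inner_smul_left, hx, mul_zero]

/-- Parseval's identity for `P v` and `u`. It serves both the spectral measure built from the basis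
and an arbitrary diagonal one. -/
theorem hasSum_inner_proj {P : H →L[ℂ] H} (hP : IsSelfAdjoint P) {s : Set ℝ}
    (h1 : ∀ i, lam i ∈ s → P (b i) = b i) (h2 : ∀ i, lam i ∉ s → P (b i) = 0) (u v : H) :
    HasSum (fun i => s.indicator 1 (lam i) * (inner ℂ v (b i) * inner ℂ (b i) u))
      (inner ℂ v (P u)) := by
  have ha : ∀ x y : H, inner ℂ (P x) y = inner ℂ x (P y) := fun x y => by
    rw [← ContinuousLinearMap.adjoint_inner_right, ContinuousLinearMap.isSelfAdjoint_iff'.1 hP]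
  rw [← ha]
  have h3 : (fun i => s.indicator 1 (lam i) * (inner ℂ v (b i) * inner ℂ (b i) u)) =
      fun i => inner ℂ (P v) (b i) * inner ℂ (b i) u := by
    ext i
    rw [ha]
    by_cases h : lam i ∈ s
    · simp [h, h1 i h]
    · simp [h, h2 i h]
  rw [h3]
  exact b.hasSum_inner_mul_inner (P v) u

/-- The spectral measure with `E({lam i}) b i = b i` for all `i`. -/
noncomputable def basisSpectralMeasure (b : HilbertBasis ι ℂ H) (lam : ι → ℝ) :
    SpectralMeasure H where
  proj := spectralProj b lam
  isStarProjection s _ := isStarProjection_starProjection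
  proj_empty := ext_basis b fun i => spectralProj_of_notMem (Set.notMem_empty _)
  proj_univ := ext_basis b fun i => spectralProj_of_mem (Set.mem_univ _)
  proj_inter s t _ _ := ext_basis b fun i => by
    rw [ContinuousLinearMap.mul_def, ContinuousLinearMap.comp_apply]
    by_cases ht : lam i ∈ t
    · rw [spectralProj_of_mem ht]
      by_cases hs : lam i ∈ s
      · rw [spectralProj_of_mem hs, spectralProj_of_mem (Set.mem_inter hs ht)]
      · rw [spectralProj_of_notMem hs, spectralProj_of_notMem fun h => hs h.1]
    · rw [spectralProj_of_notMem ht, map_zero, spectralProj_of_notMem fun h => ht h.2]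
  proj_union s t _ _ hd := ext_basis b fun i => by
    rw [add_apply]
    by_cases ht : lam i ∈ t
    · have hs : lam i ∉ s := fun hs => Set.disjoint_left.1 hd hs ht
      rw [spectralProj_of_mem ht, spectralProj_of_notMem hs, zero_add,
        spectralProj_of_mem (Or.inr ht)]
    · rw [spectralProj_of_notMem ht, add_zero]
      by_cases hs : lam i ∈ s
      · rw [spectralProj_of_mem hs, spectralProj_of_mem (Or.inl hs)]
      · rw [spectralProj_of_notMem hs, spectralProj_of_notMem fun h => h.elim hs ht]
  hasSum_inner u v s _ hd := by
    let c : ι → ℂ := fun i => inner ℂ v (b i) * inner ℂ (b i) u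
    have hind : ∀ s : Set ℝ, (fun i => s.indicator 1 (lam i) * c i) =
        (lam ⁻¹' s).indicator c := by
      intro s
      ext i
      by_cases h : lam i ∈ s <;> simp [Set.indicator, h]
    have key : ∀ s : Set ℝ, HasSum ((lam ⁻¹' s).indicator c)
        (inner ℂ v (spectralProj b lam s u)) := by
      intro s
      rw [← hind]
      exact hasSum_inner_proj isStarProjection_starProjection.isSelfAdjoint
        (fun i => spectralProj_of_mem) (fun i => spectralProj_of_notMem) u v
    have hd' : Pairwise (Function.onFun Disjoint fun n => lam ⁻¹' s n) :=
      fun m n hmn => (hd hmn).preimage lam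
    -- Countable additivity is a regrouping of one summable family along the disjoint index sets
    -- `lam ⁻¹' s n`.
    have h1 := key (⋃ n, s n)
    rw [Set.preimage_iUnion, ← hasSum_subtype_iff_indicator,
      ← (Set.unionEqSigmaOfDisjoint hd').symm.hasSum_iff] at h1
    refine h1.sigma fun n => ?_
    exact hasSum_subtype_iff_indicator.2 (key (s n))

/-- The vectors `b i` are eigenvectors of the spectral measure `E`. -/
def IsDiagonal (E : SpectralMeasure H) (b : HilbertBasis ι ℂ H) (lam : ι → ℝ) : Prop :=
  ∀ i, E.proj {lam i} (b i) = b i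

namespace IsDiagonal

variable {E : SpectralMeasure H} (hE : IsDiagonal E b lam)

include hE

theorem proj_of_mem {s : Set ℝ} (hs : MeasurableSet s) {i : ι} (h : lam i ∈ s) :
    E.proj s (b i) = b i := by
  have h1 := E.proj_inter s {lam i} hs (measurableSet_singleton _)
  rw [Set.inter_eq_self_of_subset_right (Set.singleton_subset_iff.2 h)] at h1
  have h2 := congrArg (fun T : H →L[ℂ] H => T (b i)) h1
  simp only [ContinuousLinearMap.mul_def, ContinuousLinearMap.comp_apply, hE i] at h2
  exact h2.symm

theorem proj_of_notMem {s : Set ℝ} (hs : MeasurableSet s) {i : ι} (h : lam i ∉ s) :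
    E.proj s (b i) = 0 := by
  have h1 := E.proj_inter s {lam i} hs (measurableSet_singleton _)
  rw [Set.inter_singleton_eq_empty.2 h, E.proj_empty] at h1
  have h2 := congrArg (fun T : H →L[ℂ] H => T (b i)) h1
  simp only [ContinuousLinearMap.mul_def, ContinuousLinearMap.comp_apply, hE i] at h2
  exact h2.symm

theorem hasSum_complexMeasure (u v : H) {s : Set ℝ} (hs : MeasurableSet s) :
    HasSum (fun i => s.indicator 1 (lam i) * (inner ℂ v (b i) * inner ℂ (b i) u))
      (E.complexMeasure u v s) := by
  rw [E.complexMeasure_apply u v hs]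
  exact hasSum_inner_proj (E.isStarProjection s hs).isSelfAdjoint
    (fun i => hE.proj_of_mem hs) (fun i => hE.proj_of_notMem hs) u v

theorem diagMeasure_eq (u : H) :
    E.diagMeasure u = atomicMeasure (fun i => inner ℂ u (b i) * inner ℂ (b i) u) lam := by
  ext s hs
  rw [E.diagMeasure_apply u hs, atomicMeasure_apply _ _ hs]
  have h := hE.hasSum_complexMeasure u u hs
  rw [E.complexMeasure_apply u u hs, E.inner_proj_self u hs] at h
  have h' : HasSum (fun i => ‖s.indicator 1 (lam i) * (inner ℂ u (b i) * inner ℂ (b i) u)‖)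
      (‖E.proj s u‖ ^ 2) := by
    rw [← Complex.hasSum_ofReal]
    convert h using 2 with i
    by_cases hi : lam i ∈ s
    · simp only [hi, Set.indicator_of_mem, Pi.one_apply, one_mul, norm_mul]
      rw [norm_inner_symm, ← inner_conj_symm u (b i), Complex.conj_mul']
      push_cast
      ring
    · simp [hi]
  rw [← h'.tsum_eq, ENNReal.ofReal_tsum_of_nonneg (fun i => norm_nonneg _) h'.summable]
  simp only [ofReal_norm]

/-- Membership in the graph of `∫ φ dE` can be read off from the coefficients. -/
theorem mem_opGraph_iff [Countable ι] {φ : ℝ → ℂ} {u w : H} :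
    (u, w) ∈ E.opGraph φ ↔ ∀ i, inner ℂ (b i) w = φ (lam i) * inner ℂ (b i) u := by
  constructor
  · rintro ⟨-, h⟩ i
    -- Testing with `v = b i` leaves only the `i`-th atom.
    classical
    have h1 := (cintegral_of_hasSum (φ := φ)
      (summable_inner_mul b u (b i)) (fun s => hE.hasSum_complexMeasure u (b i))
      (summable_of_hasFiniteSupport ?_)).2
    · rw [(h (b i)).2]
      simp only
      rw [h1, tsum_eq_single i]
      · rw [inner_basis_self, one_mul, mul_comm]
      · intro j hj
        rw [b.orthonormal.2 hj.symm, zero_mul, zero_mul]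
    · refine (Set.finite_singleton i).subset fun j hj => ?_
      by_contra hij
      apply hj
      simp only
      rw [b.orthonormal.2 fun h => hij h.symm, zero_mul, zero_mul]
  · intro h
    refine ⟨?_, fun v => ?_⟩
    · simp only
      rw [hE.diagMeasure_eq, lintegral_atomicMeasure]
      -- The integral of `|φ|²` is `∑ |⟨b i, w⟩|²`, which is finite because `w` already lies in `H`.
      have h1 := tsum_enorm_lt_top (summable_inner_mul b w w)
      convert h1 using 3 with i
      rw [h i, ← inner_conj_symm w, h i, ← inner_conj_symm u]
      simp only [map_mul, enorm_mul, RCLike.enorm_conj]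
      ring
    · have h1 : ∀ i, inner ℂ v (b i) * inner ℂ (b i) u * φ (lam i) =
          inner ℂ v (b i) * inner ℂ (b i) w := fun i => by rw [h i]; ring
      have h2 := cintegral_of_hasSum (φ := φ)
        (summable_inner_mul b u v) (fun s => hE.hasSum_complexMeasure u v)
        (by simpa only [h1] using summable_inner_mul b w v)
      refine ⟨h2.1, ?_⟩
      simp only
      rw [h2.2]
      simp only [h1]
      exact (b.tsum_inner_mul_inner v w).symm

end IsDiagonal

theorem isDiagonal_basisSpectralMeasure : IsDiagonal (basisSpectralMeasure b lam) b lam :=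
  fun _ => spectralProj_of_mem rfl

variable {A : H →ₗ.[ℂ] H}

/-- This existence ensures that `spectralMeasure A` is not its default value `diracZero`. -/
theorem IsEigenbasis.isSpectralMeasureOf [Countable ι] (hb : IsEigenbasis A b lam) :
    IsSpectralMeasureOf A (basisSpectralMeasure b lam) := by
  refine ⟨ext_basis b fun i => ?_, fun u v => ?_⟩
  · refine spectralProj_of_notMem ?_
    simp [hb.realSpectrum_eq]
  · exact ((isDiagonal_basisSpectralMeasure.mem_opGraph_iff (φ := fun s : ℝ => (s : ℂ))).2
      fun i => hb.inner_apply i u).2 v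

/-- Every spectral measure of `A` is diagonal in an eigenbasis of `A`. -/
theorem IsEigenbasis.isDiagonal [Countable ι] (hb : IsEigenbasis A b lam) {E : SpectralMeasure H}
    (hE : IsSpectralMeasureOf A E) : IsDiagonal E b lam := by
  intro i
  -- The complex measure of `b i` against `E({s}) y` is a point mass at `s`. Evaluating `⟨A (b i),
  -- E({s}) y⟩` in two ways gives `(lam i - s) ⟨E({s}) (b i), y⟩ = 0`.
  have horth : ∀ s, s ≠ lam i → E.proj {s} (b i) = 0 := by
    intro s hs
    obtain ⟨x, hx, hy⟩ := (LinearPMap.mem_graph_iff _).1 (hb.mem_graph i)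
    simp only at hx hy
    refine ext_inner_left ℂ fun y => ?_
    rw [inner_zero_right]
    have hsa := ContinuousLinearMap.isSelfAdjoint_iff'.1
      (E.isStarProjection {s} (measurableSet_singleton s)).isSelfAdjoint
    have ha : ∀ z : H, inner ℂ (E.proj {s} y) z = inner ℂ y (E.proj {s} z) := fun z => by
      rw [← ContinuousLinearMap.adjoint_inner_right, hsa]
    have h1 := (hE.2 x (E.proj {s} y)).2
    have h2 := cintegral_of_hasSum (ι := Unit) (μ := E.complexMeasure (b i) (E.proj {s} y))
      (c := fun _ => inner ℂ y (E.proj {s} (b i))) (lam := fun _ => s)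
      (φ := fun s : ℝ => (s : ℂ)) (summable_of_hasFiniteSupport (Set.toFinite _)) ?_
      (summable_of_hasFiniteSupport (Set.toFinite _))
    · rw [hx, h2.2, hy, inner_smul_right, ha, tsum_fintype] at h1
      simp only [Finset.univ_unique, Finset.sum_const, Finset.card_singleton, one_smul] at h1
      have h3 : ((lam i : ℂ) - s) * inner ℂ y (E.proj {s} (b i)) = 0 := by
        rw [sub_mul, h1]
        ring
      refine (mul_eq_zero.1 h3).resolve_left (sub_ne_zero.2 ?_)
      exact_mod_cast hs.symm
    · intro t ht
      have h4 := E.proj_inter {s} t (measurableSet_singleton s) ht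
      have h5 := congrArg (fun T : H →L[ℂ] H => T (b i)) h4
      simp only [ContinuousLinearMap.mul_def, ContinuousLinearMap.comp_apply] at h5
      rw [E.complexMeasure_apply _ _ ht, ha, ← h5]
      by_cases hst : s ∈ t
      · rw [Set.inter_eq_self_of_subset_left (Set.singleton_subset_iff.2 hst)]
        simp [hst, hasSum_unique]
      · rw [Set.singleton_inter_eq_empty.2 hst, E.proj_empty]
        simp [hst]
  have hmeas : MeasurableSet (Set.range lam) := (Set.countable_range lam).measurableSet
  -- `E` vanishes off the spectrum, and the spectrum is countable, so excluding the other points one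
  -- at a time suffices.
  have hnull : E.diagMeasure (b i) ({lam i}ᶜ) = 0 := by
    have hsub : ({lam i}ᶜ : Set ℝ) ⊆
        (Set.range lam)ᶜ ∪ ⋃ s ∈ (Set.range lam \ {lam i}), {s} := by
      intro s hs
      by_cases h : s ∈ Set.range lam
      · exact Or.inr (Set.mem_biUnion ⟨h, hs⟩ rfl)
      · exact Or.inl h
    refine measure_mono_null hsub (measure_union_null ?_ ?_)
    · rw [E.diagMeasure_apply _ hmeas.compl, ← hb.realSpectrum_eq, hE.1]
      simp
    · refine (measure_biUnion_null_iff ((Set.countable_range lam).mono Set.sdiff_subset)).2 ?_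
      rintro s ⟨-, hs⟩
      rw [E.diagMeasure_apply _ (measurableSet_singleton s), horth s hs]
      simp
  rw [E.diagMeasure_apply _ (measurableSet_singleton _).compl] at hnull
  have h0 : E.proj ({lam i}ᶜ) (b i) = 0 := by
    have := ENNReal.ofReal_eq_zero.1 hnull
    exact norm_eq_zero.1 (pow_eq_zero_iff two_ne_zero |>.1 (le_antisymm this (by positivity)))
  have h1 := E.proj_union {lam i} ({lam i}ᶜ) (measurableSet_singleton _)
    (measurableSet_singleton _).compl disjoint_compl_right
  rw [Set.union_compl_self, E.proj_univ] at h1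
  have h2 := congrArg (fun T : H →L[ℂ] H => T (b i)) h1
  simpa [h0] using h2.symm

theorem IsEigenbasis.isDiagonal_spectralMeasure [Countable ι] (hb : IsEigenbasis A b lam) :
    IsDiagonal (spectralMeasure A) b lam := by
  have h : ∃ E : SpectralMeasure H, IsSpectralMeasureOf A E := ⟨_, hb.isSpectralMeasureOf⟩
  rw [spectralMeasure, dif_pos h]
  exact hb.isDiagonal h.choose_spec

theorem IsEigenbasis.mem_funCalc_graph_iff [Countable ι] (hb : IsEigenbasis A b lam) {φ : ℝ → ℂ}
    {u w : H} : (u, w) ∈ (funCalc A φ).graph ↔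
      ∀ i, inner ℂ (b i) w = φ (lam i) * inner ℂ (b i) u := by
  rw [funCalc, SpectralMeasure.op_graph, hb.isDiagonal_spectralMeasure.mem_opGraph_iff]
  have h : ∀ i, lam i ∈ realSpectrum A := fun i => hb.realSpectrum_eq ▸ Set.mem_range_self i
  simp only [h, Set.indicator_of_mem]

end SpectralMeasure

end DampedWave

namespace DampedWave

/-! ### Completeness of the phase space and its modes. -/

section PhaseSpace

variable {H : Type*} [NormedAddCommGroup H] [InnerProductSpace ℂ H] [CompleteSpace H]
  {ι : Type*} {b : HilbertBasis ι ℂ H} {lam : ι → ℝ} {A : H →ₗ.[ℂ] H}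

theorem H1.mem_graph (u : H1 A) : (H1.incl A u, H1.sqrtMap A u) ∈ (sqrtOp A).graph :=
  (sqrtOp A).mem_graph u

theorem H1.exists_of_mem_graph {u w : H} (h : (u, w) ∈ (sqrtOp A).graph) :
    ∃ x : H1 A, H1.incl A x = u ∧ H1.sqrtMap A x = w :=
  (LinearPMap.mem_graph_iff _).1 h

theorem memℓp_of_le {f g : ι → ℂ} {C : ℝ} (hg : Memℓp g 2) (h : ∀ i, ‖f i‖ ≤ C * ‖g i‖) :
    Memℓp f 2 := by
  have h2 : (0 : ℝ) < (2 : ℝ≥0∞).toReal := by norm_num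
  rw [memℓp_gen_iff h2] at hg ⊢
  refine Summable.of_nonneg_of_le (fun i => by positivity) (fun i => ?_) (hg.mul_left (C ^ 2))
  have := pow_le_pow_left₀ (norm_nonneg _) (h i) 2
  simpa [mul_pow] using this

variable [Countable ι] (hb : IsEigenbasis A b lam)

include hb

namespace IsEigenbasis

/-- Dividing the coefficients by `√(lam i) ≥ √c` preserves square summability. As `sqrtMap` induces
the seminorm of `H1 A`, completeness carries over from `H`. -/
theorem sqrtMap_surjective : Function.Surjective (H1.sqrtMap A) := by
  intro w
  obtain ⟨c, hc, hle⟩ := hb.exists_le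
  have hmem : Memℓp (fun i => (Real.sqrt (lam i) : ℂ)⁻¹ * inner ℂ (b i) w) 2 := by
    refine memℓp_of_le (C := (Real.sqrt c)⁻¹) (lp.memℓp (b.repr w)) fun i => ?_
    rw [norm_mul, b.repr_apply_apply, norm_inv, Complex.norm_real, Real.norm_of_nonneg
      (Real.sqrt_nonneg _)]
    gcongr
    exact hle i
  obtain ⟨x, -, hx⟩ := H1.exists_of_mem_graph (A := A) (u := b.repr.symm ⟨_, hmem⟩) (w := w) <| by
    refine hb.mem_funCalc_graph_iff.2 fun i => ?_
    rw [← b.repr_apply_apply (b.repr.symm _), LinearIsometryEquiv.apply_symm_apply]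
    have h0 : (Real.sqrt (lam i) : ℂ) ≠ 0 := by
      exact_mod_cast (Real.sqrt_pos.2 (hb.pos i)).ne'
    change inner ℂ (b i) w = (Real.sqrt (lam i) : ℂ) * ((Real.sqrt (lam i) : ℂ)⁻¹ * inner ℂ (b i) w)
    rw [mul_inv_cancel_left₀ h0]
  exact ⟨x, hx⟩

theorem completeSpace_H1 : CompleteSpace (H1 A) := by
  have hi : IsUniformInducing (H1.sqrtMap A) := ⟨rfl⟩
  exact (hi.completeSpace_congr hb.sqrtMap_surjective).2 inferInstance

theorem completeSpace_phaseSpace : CompleteSpace (PhaseSpace A) := by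
  have := hb.completeSpace_H1
  infer_instance

omit hb [Countable ι] in
theorem _root_.DampedWave.norm_sq_phaseSpace (z : PhaseSpace A) :
    ‖z‖ ^ 2 = ‖H1.sqrtMap A z.fst‖ ^ 2 + ‖z.snd‖ ^ 2 :=
  WithLp.prod_norm_sq_eq_of_L2 z

omit hb [Countable ι] in
variable (A) in
/-- The linear isometry `(u, v) ↦ (A^{1/2} u, v)` of the phase space into `H × H`. -/
noncomputable def _root_.DampedWave.phaseEmbed : PhaseSpace A →ₗᵢ[ℂ] WithLp 2 (H × H) where
  toFun z := WithLp.toLp 2 (H1.sqrtMap A z.fst, z.snd)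
  map_add' x y := by simp; rfl
  map_smul' c x := by simp; rfl
  norm_map' x := by
    have h : ‖WithLp.toLp 2 (H1.sqrtMap A x.fst, x.snd)‖ ^ 2 = ‖x‖ ^ 2 := by
      rw [WithLp.prod_norm_sq_eq_of_L2, norm_sq_phaseSpace]
      rfl
    exact (pow_left_inj₀ (norm_nonneg _) (norm_nonneg _) two_ne_zero).1 h

theorem exists_mode (i : ι) :
    ∃ e : H1 A, H1.incl A e = b i ∧ H1.sqrtMap A e = (Real.sqrt (lam i) : ℂ) • b i := by
  refine H1.exists_of_mem_graph (hb.mem_funCalc_graph_iff.2 fun j => ?_)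
  rw [inner_smul_right]
  by_cases h : j = i
  · rw [h]
  · rw [b.orthonormal.2 h, mul_zero, mul_zero]

/-- The vector `b i` as an element of `D(A^{1/2})`. -/
noncomputable def mode (i : ι) : H1 A := (hb.exists_mode i).choose

theorem incl_mode (i : ι) : H1.incl A (hb.mode i) = b i := (hb.exists_mode i).choose_spec.1

theorem sqrtMap_mode (i : ι) : H1.sqrtMap A (hb.mode i) = (Real.sqrt (lam i) : ℂ) • b i :=
  (hb.exists_mode i).choose_spec.2

/-- The vector `(x b i, y b i)` of the phase space. -/
noncomputable def modeVec (i : ι) (x y : ℂ) : PhaseSpace A :=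
  WithLp.toLp 2 (x • hb.mode i, y • b i)

/-- Against `b i`, the dual pairing sees only the `i`-th coefficient of `w`, on which `A` and `f(A)`
act as real scalars. So each mode plane is invariant under the generator. -/
theorem modeVec_mem_waveGraph (f : ℝ → ℝ) (i : ι) (x y : ℂ) :
    (hb.modeVec i x y, hb.modeVec i y (-lam i * x - f (lam i) * y)) ∈ waveGraph A f := by
  refine ⟨?_, fun w w' hw => ?_⟩
  · simp [modeVec, hb.incl_mode]
  · have h1 : inner ℂ (A w) (b i) = lam i * inner ℂ (w : H) (b i) := by
      rw [← inner_conj_symm, hb.inner_apply, map_mul, inner_conj_symm, Complex.conj_ofReal]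
    have h2 : inner ℂ (dampOp A f w') (b i) = f (lam i) * inner ℂ (w : H) (b i) := by
      rw [← inner_conj_symm, hb.mem_funCalc_graph_iff.1 ((dampOp A f).mem_graph w') i, map_mul,
        inner_conj_symm, Complex.conj_ofReal, hw]
    simp only [modeVec, map_smul, hb.incl_mode, inner_smul_right, h1, h2, inner_neg_right,
      WithLp.toLp_fst, WithLp.toLp_snd]
    ring

theorem sqrtMap_sum_modeVec (F : Finset ι) (x y : ι → ℂ) :
    H1.sqrtMap A (∑ i ∈ F, hb.modeVec i (x i) (y i)).fst =
      ∑ i ∈ F, (x i * Real.sqrt (lam i)) • b i := by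
  have h := map_sum ((H1.sqrtMap A).comp ((LinearMap.fst ℂ (H1 A) H).comp
      (WithLp.linearEquiv 2 ℂ (H1 A × H)).toLinearMap)) (fun i => hb.modeVec i (x i) (y i)) F
  refine h.trans ?_
  simp [modeVec, hb.sqrtMap_mode, mul_smul]

theorem snd_sum_modeVec (F : Finset ι) (x y : ι → ℂ) :
    (∑ i ∈ F, hb.modeVec i (x i) (y i)).snd = ∑ i ∈ F, y i • b i := by
  have h := map_sum ((LinearMap.snd ℂ (H1 A) H).comp
      (WithLp.linearEquiv 2 ℂ (H1 A × H)).toLinearMap) (fun i => hb.modeVec i (x i) (y i)) F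
  refine h.trans ?_
  simp [modeVec]

theorem norm_sum_modeVec_sq (F : Finset ι) (x y : ι → ℂ) :
    ‖∑ i ∈ F, hb.modeVec i (x i) (y i)‖ ^ 2 =
      ∑ i ∈ F, (lam i * ‖x i‖ ^ 2 + ‖y i‖ ^ 2) := by
  have hn : ∀ c : ι → ℂ, ‖∑ i ∈ F, c i • b i‖ ^ 2 = ∑ i ∈ F, ‖c i‖ ^ 2 := by
    intro c
    have h := b.orthonormal.inner_sum c c F
    rw [inner_self_eq_norm_sq_to_K] at h
    simp only [Complex.conj_mul'] at h
    apply Complex.ofReal_injective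
    push_cast
    exact h
  rw [norm_sq_phaseSpace, hb.sqrtMap_sum_modeVec, hb.snd_sum_modeVec, hn, hn, ← Finset.sum_add_distrib]
  refine Finset.sum_congr rfl fun i _ => ?_
  rw [norm_mul, mul_pow, Complex.norm_real, Real.norm_of_nonneg (Real.sqrt_nonneg _),
    Real.sq_sqrt (hb.pos i).le, mul_comm]

/-- Finite sums of modes are dense in the phase space. -/
theorem dense_sum_modeVec :
    Dense {z : PhaseSpace A | ∃ (F : Finset ι) (x y : ι → ℂ),
      z = ∑ i ∈ F, hb.modeVec i (x i) (y i)} := by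
  intro z
  -- The first component is expanded through `A^{1/2}`, since convergence is needed in the energy
  -- norm; hence the factor `1 / √(lam i)`.
  set x : ι → ℂ := fun i => (Real.sqrt (lam i) : ℂ)⁻¹ * b.repr (H1.sqrtMap A z.fst) i
  set y : ι → ℂ := fun i => b.repr z.snd i
  refine mem_closure_of_tendsto (f := fun F => ∑ i ∈ F, hb.modeVec i (x i) (y i))
    (b := atTop) ?_ (Eventually.of_forall fun F => ⟨F, x, y, rfl⟩)
  have h1 := (b.hasSum_repr (H1.sqrtMap A z.fst)).prodMk (b.hasSum_repr z.snd)
  have h2 : Tendsto (fun F => phaseEmbed A (∑ i ∈ F, hb.modeVec i (x i) (y i))) atTop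
      (𝓝 (phaseEmbed A z)) := by
    have h3 := (WithLp.prod_continuous_toLp 2 H H).continuousAt.tendsto.comp h1
    refine h3.congr fun F => ?_
    change WithLp.toLp 2 _ = WithLp.toLp 2 (_, _)
    rw [hb.sqrtMap_sum_modeVec, hb.snd_sum_modeVec]
    congr 1
    rw [Prod.ext_iff, Prod.fst_sum, Prod.snd_sum]
    refine ⟨Finset.sum_congr rfl fun i _ => ?_, rfl⟩
    have h0 : (Real.sqrt (lam i) : ℂ) ≠ 0 := by
      exact_mod_cast (Real.sqrt_pos.2 (hb.pos i)).ne'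
    simp only [x]
    rw [mul_comm, mul_inv_cancel_left₀ h0]
  rw [tendsto_iff_norm_sub_tendsto_zero] at h2 ⊢
  simpa only [← map_sub, LinearIsometry.norm_map] using h2

end IsEigenbasis

end PhaseSpace

end DampedWave

namespace DampedWave

/-! ### Strongly continuous semigroups and uniqueness of trajectories. -/

namespace C0Semigroup

variable {X : Type*} [SeminormedAddCommGroup X] [NormedSpace ℂ X] (S : C0Semigroup X)

theorem zero_apply (x : X) : S.toFun 0 x = x := by rw [S.zero]; rfl

theorem add_apply {s t : ℝ} (hs : 0 ≤ s) (ht : 0 ≤ t) (x : X) :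
    S.toFun (s + t) x = S.toFun s (S.toFun t x) := by rw [S.add s t hs ht]; rfl

theorem tendsto_nhdsGE (x : X) : Tendsto (fun t => S.toFun t x) (𝓝[≥] 0) (𝓝 x) := by
  have h : ContinuousWithinAt (fun t => S.toFun t x) (Set.Ioi 0) 0 := by
    rw [ContinuousWithinAt, S.zero_apply]
    exact S.tendsto x
  have h' := h.insert
  rw [Set.Ioi_insert, ContinuousWithinAt, S.zero_apply] at h'
  exact h'

/-- Otherwise some `t n → 0` has `‖S(t n)‖ > n`, although every orbit converges along it; this
contradicts Banach–Steinhaus. -/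
theorem exists_bound_near_zero [CompleteSpace X] :
    ∃ δ > 0, ∃ C, ∀ t, 0 ≤ t → t ≤ δ → ‖S.toFun t‖ ≤ C := by
  by_contra! h
  choose t ht0 ht1 ht using fun n : ℕ => h (1 / ((n : ℝ) + 1)) (by positivity) n
  have hlim : Tendsto t atTop (𝓝[≥] 0) :=
    tendsto_nhdsWithin_iff.2 ⟨squeeze_zero ht0 ht1 tendsto_one_div_add_atTop_nhds_zero_nat,
      Eventually.of_forall ht0⟩
  obtain ⟨C, hC⟩ := banach_steinhaus (g := fun n => S.toFun (t n)) fun x => by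
    obtain ⟨C, hC⟩ := ((S.tendsto_nhdsGE x).comp hlim).norm.bddAbove_range
    exact ⟨C, fun n => hC ⟨n, rfl⟩⟩
  obtain ⟨n, hn⟩ := exists_nat_gt C
  exact absurd ((ht n).trans_le (hC n)) hn.not_gt

theorem exists_bound [CompleteSpace X] (T : ℝ) :
    ∃ C, ∀ t, 0 ≤ t → t ≤ T → ‖S.toFun t‖ ≤ C := by
  obtain ⟨δ, hδ, C, hC⟩ := S.exists_bound_near_zero
  have h : ∀ n : ℕ, ∃ C', ∀ t, 0 ≤ t → t ≤ n * δ → ‖S.toFun t‖ ≤ C' := by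
    intro n
    induction n with
    | zero => exact ⟨C, fun t h0 h1 => hC t h0 (by simp at h1; linarith)⟩
    | succ n ih =>
      obtain ⟨C', hC'⟩ := ih
      refine ⟨max C (C * C'), fun t h0 h1 => ?_⟩
      rcases le_total t δ with h | h
      · exact (hC t h0 h).trans (le_max_left _ _)
      · refine le_trans ?_ (le_max_right _ _)
        have h2 : S.toFun t = (S.toFun δ).comp (S.toFun (t - δ)) := by
          rw [← S.add δ (t - δ) hδ.le (by linarith)]
          congr 1
          ring
        rw [h2]
        refine (ContinuousLinearMap.opNorm_comp_le _ _).trans ?_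
        have h3 := hC δ hδ.le le_rfl
        have h4 := hC' (t - δ) (by linarith) (by push_cast at h1; linarith)
        have h5 := (norm_nonneg (S.toFun δ)).trans h3
        gcongr
  obtain ⟨n, hn⟩ := exists_nat_gt (T / δ)
  obtain ⟨C', hC'⟩ := h n
  exact ⟨C', fun t h0 h1 => hC' t h0 (h1.trans ((div_lt_iff₀ hδ).1 hn).le)⟩

theorem norm_apply_sub_apply_le {s t : ℝ} (hs : 0 ≤ s) (hst : s ≤ t) (x : X) :
    ‖S.toFun t x - S.toFun s x‖ ≤ ‖S.toFun s‖ * ‖S.toFun (t - s) x - x‖ := by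
  have h : S.toFun t x = S.toFun s (S.toFun (t - s) x) := by
    rw [← S.add_apply hs (by linarith)]
    congr 2
    ring
  rw [h, ← map_sub]
  exact (S.toFun s).le_opNorm _

/-- Factoring out `S(min s t)`, which is bounded on `[0, T]`, reduces two-sided continuity to right
continuity at `0`. -/
theorem continuousOn_Icc [CompleteSpace X] (T : ℝ) (x : X) :
    ContinuousOn (fun t => S.toFun t x) (Set.Icc 0 T) := by
  obtain ⟨C, hC⟩ := S.exists_bound T
  intro s hs
  rw [ContinuousWithinAt, tendsto_iff_norm_sub_tendsto_zero]
  have h1 : Tendsto (fun t => |t - s|) (𝓝[Set.Icc 0 T] s) (𝓝[≥] 0) := by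
    refine tendsto_nhdsWithin_iff.2 ⟨?_, Eventually.of_forall fun t => Set.mem_Ici.2 (abs_nonneg _)⟩
    have : ContinuousWithinAt (fun t => |t - s|) (Set.Icc 0 T) s := by fun_prop
    simpa [ContinuousWithinAt] using this
  have h2 := (tendsto_iff_norm_sub_tendsto_zero.1 ((S.tendsto_nhdsGE x).comp h1)).const_mul C
  rw [mul_zero] at h2
  refine squeeze_zero' (Eventually.of_forall fun t => norm_nonneg _) ?_ h2
  filter_upwards [self_mem_nhdsWithin] with t ht
  simp only [Function.comp_apply]
  rcases le_total s t with h | h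
  · rw [abs_of_nonneg (sub_nonneg.2 h)]
    refine (S.norm_apply_sub_apply_le hs.1 h x).trans ?_
    gcongr
    exact hC s hs.1 hs.2
  · rw [abs_of_nonpos (sub_nonpos.2 h), neg_sub, norm_sub_rev]
    refine (S.norm_apply_sub_apply_le ht.1 h x).trans ?_
    gcongr
    exact hC t ht.1 ht.2

variable {K : Type*} [NormedAddCommGroup K] [NormedSpace ℂ K]

/-- `X` has only a seminorm, so orbits are observed through `Φ` in a normed space, where ODE
uniqueness applies. -/
theorem hasDerivWithinAt (Φ : X →L[ℂ] K) {x y : X} (h : (x, y) ∈ S.generatorGraph) {t : ℝ}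
    (ht : 0 ≤ t) :
    HasDerivWithinAt (fun t => Φ (S.toFun t x)) (Φ (S.toFun t y)) (Set.Ici t) t := by
  rw [← hasDerivWithinAt_Ioi_iff_Ici, hasDerivWithinAt_iff_tendsto_slope' Set.self_notMem_Ioi]
  have h1 : Tendsto (fun r => r - t) (𝓝[>] t) (𝓝[>] 0) := by
    refine tendsto_nhdsWithin_iff.2 ⟨?_, ?_⟩
    · have : ContinuousWithinAt (fun r => r - t) (Set.Ioi t) t := by fun_prop
      simpa [ContinuousWithinAt] using this
    · filter_upwards [self_mem_nhdsWithin] with r hr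
      exact Set.mem_Ioi.2 (sub_pos.2 (Set.mem_Ioi.1 hr))
  have h2 := ((Φ.comp (S.toFun t)).continuous.tendsto y).comp (Tendsto.comp h h1)
  refine h2.congr' ?_
  filter_upwards [self_mem_nhdsWithin] with r hr
  have h3 : S.toFun r x = S.toFun t (S.toFun (r - t) x) := by
    rw [← S.add_apply ht (sub_pos.2 (Set.mem_Ioi.1 hr)).le]
    congr 2
    ring
  simp only [Function.comp_apply, slope, vsub_eq_sub, ContinuousLinearMap.comp_apply]
  rw [h3, map_smul, map_smul, map_sub, map_sub, Complex.coe_smul]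

/-- On a plane spanned by `x₁, x₂` with `x₁ ↦ α x₂`, `x₂ ↦ β x₁ + γ x₂` under the generator, the
semigroup is given by the fundamental solution of the corresponding linear system. -/
theorem apply_eq_of_generator [CompleteSpace X] (Φ : X →L[ℂ] K) {x₁ x₂ : X} {α β γ : ℂ}
    (h₁ : (x₁, α • x₂) ∈ S.generatorGraph) (h₂ : (x₂, β • x₁ + γ • x₂) ∈ S.generatorGraph)
    {p₁ q₁ p₂ q₂ : ℝ → ℂ}
    (hp₁ : ∀ t, HasDerivAt p₁ (α * p₂ t) t) (hq₁ : ∀ t, HasDerivAt q₁ (α * q₂ t) t)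
    (hp₂ : ∀ t, HasDerivAt p₂ (β * p₁ t + γ * p₂ t) t)
    (hq₂ : ∀ t, HasDerivAt q₂ (β * q₁ t + γ * q₂ t) t)
    (hp₁0 : p₁ 0 = 1) (hq₁0 : q₁ 0 = 0) (hp₂0 : p₂ 0 = 0) (hq₂0 : q₂ 0 = 1)
    {t : ℝ} (ht : 0 ≤ t) :
    Φ (S.toFun t x₁) = p₁ t • Φ x₁ + q₁ t • Φ x₂ ∧
      Φ (S.toFun t x₂) = p₂ t • Φ x₁ + q₂ t • Φ x₂ := by
  let V : K × K →L[ℂ] K × K := (α • ContinuousLinearMap.snd ℂ K K).prod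
    (β • ContinuousLinearMap.fst ℂ K K + γ • ContinuousLinearMap.snd ℂ K K)
  have hd : ∀ {p q p' q' : ℝ → ℂ} (_ : ∀ t, HasDerivAt p (p' t) t)
      (_ : ∀ t, HasDerivAt q (q' t) t) (t : ℝ),
      HasDerivAt (fun t => p t • Φ x₁ + q t • Φ x₂) (p' t • Φ x₁ + q' t • Φ x₂) t :=
    fun hp hq t => ((hp t).smul_const _).add ((hq t).smul_const _)
  have hg : ∀ t, HasDerivAt
      (fun t => (p₁ t • Φ x₁ + q₁ t • Φ x₂, p₂ t • Φ x₁ + q₂ t • Φ x₂))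
      (V (p₁ t • Φ x₁ + q₁ t • Φ x₂, p₂ t • Φ x₁ + q₂ t • Φ x₂)) t := by
    intro t
    refine ((hd hp₁ hq₁ t).prodMk (hd hp₂ hq₂ t)).congr_deriv ?_
    simp only [V, ContinuousLinearMap.prod_apply, smul_apply, ContinuousLinearMap.coe_snd',
      _root_.add_apply, ContinuousLinearMap.coe_fst', smul_add, smul_smul, add_smul]
    congr 1
    abel
  -- The derivative is used as the semigroup applied to the generator's value, so the images of `x₁`
  -- and `x₂` form a closed linear system, without knowing beforehand that orbits stay in the plane.
  have key := ODE_solution_unique (v := fun _ => V) (K := ‖V‖₊) (a := 0) (b := t)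
    (f := fun t => (Φ (S.toFun t x₁), Φ (S.toFun t x₂)))
    (g := fun t => (p₁ t • Φ x₁ + q₁ t • Φ x₂, p₂ t • Φ x₁ + q₂ t • Φ x₂))
    (fun _ => V.lipschitz) ?_ ?_ ?_ (fun t _ => (hg t).hasDerivWithinAt) ?_
  · have := key (Set.right_mem_Icc.2 ht)
    exact ⟨congrArg Prod.fst this, congrArg Prod.snd this⟩
  · exact (Φ.continuous.comp_continuousOn (S.continuousOn_Icc t x₁)).prodMk
      (Φ.continuous.comp_continuousOn (S.continuousOn_Icc t x₂))
  · intro s hs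
    exact ((S.hasDerivWithinAt Φ h₁ hs.1).prodMk (S.hasDerivWithinAt Φ h₂ hs.1)).congr_deriv
      (by simp [V])
  · exact fun s _ => (hg s).continuousAt.continuousWithinAt
  · simp [S.zero_apply, hp₁0, hq₁0, hp₂0, hq₂0]

end C0Semigroup

end DampedWave

namespace DampedWave

/-! ### The damped scalar oscillator. -/

section Oscillator

/-- `(a, b)` solves `a' = b`, `b' = -l a - f b`. -/
structure IsOscillator (l f : ℝ) (a b : ℝ → ℝ) : Prop where
  left : ∀ t, HasDerivAt a (b t) t
  right : ∀ t, HasDerivAt b (-l * a t - f * b t) t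

namespace IsOscillator

variable {l f : ℝ} {a b : ℝ → ℝ} (h : IsOscillator l f a b)

include h

theorem hasDerivAt_energy (t : ℝ) :
    HasDerivAt (fun t => l * a t ^ 2 + b t ^ 2) (-2 * f * b t ^ 2) t := by
  refine ((((h.left t).pow 2).const_mul l).add ((h.right t).pow 2)).congr_deriv ?_
  push_cast
  ring

theorem energy_antitone (hf : 0 ≤ f) : Antitone fun t => l * a t ^ 2 + b t ^ 2 := by
  refine antitone_of_deriv_nonpos (fun t => (h.hasDerivAt_energy t).differentiableAt) fun t => ?_
  rw [(h.hasDerivAt_energy t).deriv]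
  nlinarith [mul_nonneg hf (sq_nonneg (b t))]

/-- The energy dissipation sees only `b`. Adding a small cross term `2 ε a b` gives a functional
comparable to the energy whose derivative also controls `a`, hence exponential decay. -/
theorem tendsto_energy (hl : 0 < l) (hf : 0 < f) :
    Tendsto (fun t => l * a t ^ 2 + b t ^ 2) atTop (𝓝 0) := by
  -- Chosen so that one `b²` term cancels exactly after completing the square in `h4`. Moreover `4
  -- ε² ≤ l` bounds the cross term by half the energy.
  set ε := l * f / (2 * l + f ^ 2) with hε
  have hD : 0 < 2 * l + f ^ 2 := by positivity
  have hε0 : 0 < ε := by positivity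
  have hεD : ε * (2 * l + f ^ 2) = l * f := div_mul_cancel₀ _ hD.ne'
  have hε1 : 4 * ε ^ 2 ≤ l := by
    have h1 : 4 * ε ^ 2 * (2 * l + f ^ 2) ^ 2 ≤ l * (2 * l + f ^ 2) ^ 2 := by
      have : 4 * ε ^ 2 * (2 * l + f ^ 2) ^ 2 = 4 * (l * f) ^ 2 := by rw [← hεD]; ring
      rw [this]
      nlinarith [pow_pos hl 3, mul_nonneg hl.le (sq_nonneg (f ^ 2))]
    exact le_of_mul_le_mul_right h1 (by positivity)
  set L : ℝ → ℝ := fun t => l * a t ^ 2 + b t ^ 2 + 2 * ε * (a t * b t)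
  have hab : ∀ t, |2 * ε * (a t * b t)| ≤ (l * a t ^ 2 + b t ^ 2) / 2 := by
    intro t
    rw [abs_le]
    constructor
    · nlinarith [sq_nonneg (2 * ε * a t + b t), mul_le_mul_of_nonneg_right hε1 (sq_nonneg (a t))]
    · nlinarith [sq_nonneg (2 * ε * a t - b t), mul_le_mul_of_nonneg_right hε1 (sq_nonneg (a t))]
  have hL : ∀ t, HasDerivAt L (-2 * f * b t ^ 2 +
      2 * ε * (b t * b t + a t * (-l * a t - f * b t))) t := fun t =>
    (h.hasDerivAt_energy t).add (((h.left t).mul (h.right t)).const_mul (2 * ε))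
  -- Since `L` is at most `3/2` of the energy, `c * L` is at most `ε` times the energy.
  set c := 2 * ε / 3
  have hdecay : ∀ t, -2 * f * b t ^ 2 + 2 * ε * (b t * b t + a t * (-l * a t - f * b t)) ≤
      -(c * L t) := by
    intro t
    have h1 : -2 * f * b t ^ 2 + 2 * ε * (b t * b t + a t * (-l * a t - f * b t)) ≤
        -ε * (l * a t ^ 2 + b t ^ 2) := by
      have h2 : 0 ≤ ε * (l * a t + f * b t) ^ 2 := by positivity
      have h3 : 0 ≤ ε * l * b t ^ 2 := by positivity
      have h4 : (-2 * f * b t ^ 2 + 2 * ε * (b t * b t + a t * (-l * a t - f * b t)) +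
          ε * (l * a t ^ 2 + b t ^ 2)) * l =
          -(ε * (l * a t + f * b t) ^ 2) + (ε * (2 * l + f ^ 2) - l * f) * b t ^ 2 +
            (ε * l - l * f) * b t ^ 2 := by ring
      have h5 : ε ≤ f := by
        have : ε * (2 * l + f ^ 2) ≤ f * (2 * l + f ^ 2) := by
          rw [hεD]
          nlinarith [pow_pos hf 3, mul_pos hl hf]
        exact le_of_mul_le_mul_right this hD
      have h6 : (ε * l - l * f) * b t ^ 2 ≤ 0 := by
        apply mul_nonpos_of_nonpos_of_nonneg _ (sq_nonneg _)
        nlinarith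
      rw [hεD, sub_self, zero_mul] at h4
      have h7 : (-2 * f * b t ^ 2 + 2 * ε * (b t * b t + a t * (-l * a t - f * b t)) +
          ε * (l * a t ^ 2 + b t ^ 2)) ≤ 0 := by
        by_contra! hc
        have := mul_pos hc hl
        linarith
      linarith
    have h8 : c * L t ≤ ε * (l * a t ^ 2 + b t ^ 2) := by
      have := (abs_le.1 (hab t)).2
      simp only [c, L]
      nlinarith
    linarith
  have hexp : ∀ t, HasDerivAt (fun t => Real.exp (c * t)) (Real.exp (c * t) * c) t := fun t => by
    simpa using ((hasDerivAt_id t).const_mul c).exp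
  have hanti : Antitone fun t => Real.exp (c * t) * L t := by
    have hd := fun t => (hexp t).mul (hL t)
    refine antitone_of_deriv_nonpos (fun t => (hd t).differentiableAt) fun t => ?_
    have h9 := (hd t).deriv
    have h10 := mul_le_mul_of_nonneg_left (hdecay t) (Real.exp_pos (c * t)).le
    refine h9.le.trans ?_
    nlinarith
  have hc0 : 0 < c := by positivity
  have hlim : Tendsto (fun t => 2 * L 0 * Real.exp (-(c * t))) atTop (𝓝 0) := by
    have h := (Real.tendsto_exp_neg_atTop_nhds_zero.comp
      (tendsto_id.const_mul_atTop hc0)).const_mul (2 * L 0)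
    rwa [mul_zero] at h
  refine squeeze_zero' (Eventually.of_forall fun t => by positivity) ?_ hlim
  filter_upwards [eventually_ge_atTop 0] with t ht
  have h11 := hanti ht
  simp only [mul_zero, Real.exp_zero, one_mul] at h11
  have h12 : L t ≤ L 0 * Real.exp (-(c * t)) := by
    rw [Real.exp_neg, ← div_eq_mul_inv, le_div_iff₀ (Real.exp_pos _), mul_comm]
    exact h11
  have h13 := (abs_le.1 (hab t)).1
  simp only [L] at h12 h13 ⊢
  linarith

end IsOscillator

/-- The fundamental solution of `a'' + f a' + l a = 0`. -/
theorem exists_fundamental_solution (l f : ℝ) : ∃ p₁ q₁ p₂ q₂ : ℝ → ℝ,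
    IsOscillator l f p₁ q₁ ∧ IsOscillator l f p₂ q₂ ∧
    (∀ t, HasDerivAt p₁ (-l * p₂ t) t) ∧ (∀ t, HasDerivAt q₁ (-l * q₂ t) t) ∧
    (∀ t, HasDerivAt p₂ (p₁ t - f * p₂ t) t) ∧ (∀ t, HasDerivAt q₂ (q₁ t - f * q₂ t) t) ∧
    p₁ 0 = 1 ∧ q₁ 0 = 0 ∧ p₂ 0 = 0 ∧ q₂ 0 = 1 := by
  let M : ℝ × ℝ →L[ℝ] ℝ × ℝ := (ContinuousLinearMap.snd ℝ ℝ ℝ).prod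
    (-l • ContinuousLinearMap.fst ℝ ℝ ℝ - f • ContinuousLinearMap.snd ℝ ℝ ℝ)
  have hM : ∀ x y : ℝ, M (x, y) = (y, -l * x - f * y) := fun x y => rfl
  let U : ℝ → ℝ × ℝ →L[ℝ] ℝ × ℝ := fun t => NormedSpace.exp (t • M)
  -- The exponential commutes with `M`. The form `U M` yields the equations matching the semigroup
  -- derivative; the form `M U` yields the oscillator equations for the energy estimates.
  have hU : ∀ t v, HasDerivAt (fun t => U t v) (U t (M v)) t := fun t v =>
    ((hasDerivAt_exp_smul_const M t).clm_apply (hasDerivAt_const t v)).congr_deriv (by simp [U])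
  have hU' : ∀ t v, HasDerivAt (fun t => U t v) (M (U t v)) t := fun t v =>
    ((hasDerivAt_exp_smul_const' M t).clm_apply (hasDerivAt_const t v)).congr_deriv (by simp [U])
  have hU0 : ∀ v, U 0 v = v := fun v => by simp [U]
  have hlin : ∀ t x y, U t (x, y) = x • U t (1, 0) + y • U t (0, 1) := fun t x y => by
    rw [← map_smul, ← map_smul, ← map_add]
    simp
  have hfst : ∀ {g : ℝ → ℝ × ℝ} {g' : ℝ × ℝ} {t : ℝ}, HasDerivAt g g' t →
      HasDerivAt (fun t => (g t).1) g'.1 t := fun h =>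
    (ContinuousLinearMap.fst ℝ ℝ ℝ).hasFDerivAt.comp_hasDerivAt _ h
  have hsnd : ∀ {g : ℝ → ℝ × ℝ} {g' : ℝ × ℝ} {t : ℝ}, HasDerivAt g g' t →
      HasDerivAt (fun t => (g t).2) g'.2 t := fun h =>
    (ContinuousLinearMap.snd ℝ ℝ ℝ).hasFDerivAt.comp_hasDerivAt _ h
  refine ⟨fun t => (U t (1, 0)).1, fun t => (U t (1, 0)).2, fun t => (U t (0, 1)).1,
    fun t => (U t (0, 1)).2, ⟨fun t => hfst (hU' t _), fun t => hsnd (hU' t _)⟩,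
    ⟨fun t => hfst (hU' t _), fun t => hsnd (hU' t _)⟩, fun t => ?_, fun t => ?_, fun t => ?_,
    fun t => ?_, ?_, ?_, ?_, ?_⟩
  · exact (hfst (hU t _)).congr_deriv (by rw [hM, hlin]; simp)
  · exact (hsnd (hU t _)).congr_deriv (by rw [hM, hlin]; simp)
  · exact (hfst (hU t _)).congr_deriv (by rw [hM, hlin]; simp; ring)
  · exact (hsnd (hU t _)).congr_deriv (by rw [hM, hlin]; simp; ring)
  all_goals simp [hU0]

end Oscillator

end DampedWave

namespace DampedWave

/-! ### Mode evolution and the stability criterion. -/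

section Main

variable {H : Type*} [NormedAddCommGroup H] [InnerProductSpace ℂ H] [CompleteSpace H]
  {ι : Type*} {b : HilbertBasis ι ℂ H} {lam : ι → ℝ} {A : H →ₗ.[ℂ] H} [Countable ι]
  (hb : IsEigenbasis A b lam) {f : ℝ → ℝ} {S : C0Semigroup (PhaseSpace A)}
  (hS : S.generatorGraph = waveGraph A f)

theorem IsOscillator.add_mul {l g : ℝ} {p₁ q₁ p₂ q₂ : ℝ → ℝ} (h₁ : IsOscillator l g p₁ q₁)
    (h₂ : IsOscillator l g p₂ q₂) (x y : ℝ) :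
    IsOscillator l g (fun t => x * p₁ t + y * p₂ t) (fun t => x * q₁ t + y * q₂ t) where
  left t := ((h₁.left t).const_mul x).add ((h₂.left t).const_mul y)
  right t := (((h₁.right t).const_mul x).add ((h₂.right t).const_mul y)).congr_deriv (by ring)

namespace IsEigenbasis

theorem modeVec_eq (i : ι) (x y : ℂ) :
    hb.modeVec i x y = x • hb.modeVec i 1 0 + y • hb.modeVec i 0 1 := by
  simp only [modeVec, ← WithLp.toLp_smul, ← WithLp.toLp_add, Prod.smul_mk, Prod.mk_add_mk,
    one_smul, zero_smul, smul_zero, add_zero, zero_add]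

include hS in
/-- Along the mode `i` the semigroup acts as a damped oscillator. -/
theorem exists_mode_evolution (i : ι) (x y : ℂ) : ∃ u v : ℝ → ℂ,
    (∀ t, 0 ≤ t → phaseEmbed A (S.toFun t (hb.modeVec i x y)) =
      phaseEmbed A (hb.modeVec i (u t) (v t))) ∧
    IsOscillator (lam i) (f (lam i)) (fun t => (u t).re) (fun t => (v t).re) ∧
    IsOscillator (lam i) (f (lam i)) (fun t => (u t).im) (fun t => (v t).im) ∧
    u 0 = x ∧ v 0 = y := by
  have := hb.completeSpace_phaseSpace
  obtain ⟨p₁, q₁, p₂, q₂, h₁, h₂, hp₁, hq₁, hp₂, hq₂, e₁, e₂, e₃, e₄⟩ :=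
    exists_fundamental_solution (lam i) (f (lam i))
  -- On the basis `(1, 0)`, `(0, 1)` of the mode plane, the generator sends `(1, 0)` to `-lam i (0,
  -- 1)` and `(0, 1)` to `(1, 0) - f (lam i) (0, 1)`.
  have hg₁ := hb.modeVec_mem_waveGraph f i 1 0
  have hg₂ := hb.modeVec_mem_waveGraph f i 0 1
  rw [← hS, hb.modeVec_eq i 0] at hg₁
  rw [← hS, hb.modeVec_eq i 1 (-(lam i : ℂ) * 0 - f (lam i) * 1)] at hg₂
  simp only [zero_smul, zero_add, mul_one, mul_zero, sub_zero, zero_sub] at hg₁ hg₂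
  have key := fun {t : ℝ} (ht : 0 ≤ t) => S.apply_eq_of_generator
    (phaseEmbed A).toContinuousLinearMap hg₁ hg₂
    (p₁ := fun t => p₁ t) (q₁ := fun t => q₁ t) (p₂ := fun t => p₂ t) (q₂ := fun t => q₂ t)
    (fun t => (hp₁ t).ofReal_comp.congr_deriv (by push_cast; ring))
    (fun t => (hq₁ t).ofReal_comp.congr_deriv (by push_cast; ring))
    (fun t => (hp₂ t).ofReal_comp.congr_deriv (by push_cast; ring))
    (fun t => (hq₂ t).ofReal_comp.congr_deriv (by push_cast; ring))
    (by simp [e₁]) (by simp [e₂]) (by simp [e₃]) (by simp [e₄]) ht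
  refine ⟨fun t => x * p₁ t + y * p₂ t, fun t => x * q₁ t + y * q₂ t, fun t ht => ?_, ?_, ?_,
    by simp [e₁, e₃], by simp [e₂, e₄]⟩
  · obtain ⟨k₁, k₂⟩ := key ht
    simp only [LinearIsometry.coe_toContinuousLinearMap] at k₁ k₂
    rw [hb.modeVec_eq i x y, hb.modeVec_eq i (_ + _)]
    simp only [map_add, map_smul]
    rw [k₁, k₂]
    module
  · simpa using h₁.add_mul h₂ x.re y.re
  · simpa using h₁.add_mul h₂ x.im y.im

/-- The energy of a complex-valued oscillator splits into real and imaginary part. -/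
theorem _root_.DampedWave.energy_eq_re_add_im (l : ℝ) (x y : ℂ) :
    l * ‖x‖ ^ 2 + ‖y‖ ^ 2 = (l * x.re ^ 2 + y.re ^ 2) + (l * x.im ^ 2 + y.im ^ 2) := by
  rw [Complex.sq_norm, Complex.sq_norm, Complex.normSq_apply, Complex.normSq_apply]
  ring

include hS in
/-- On finite sums of modes the semigroup is contractive, and stable if the damping is positive. -/
theorem exists_energy_sum (hf0 : ∀ i, 0 ≤ f (lam i)) (F : Finset ι) (x y : ι → ℂ) :
    (∀ t, 0 ≤ t → ‖S.toFun t (∑ i ∈ F, hb.modeVec i (x i) (y i))‖ ≤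
      ‖∑ i ∈ F, hb.modeVec i (x i) (y i)‖) ∧
    ((∀ i, 0 < f (lam i)) →
      Tendsto (fun t => ‖S.toFun t (∑ i ∈ F, hb.modeVec i (x i) (y i))‖) atTop (𝓝 0)) := by
  choose u v huv hre him hu0 hv0 using fun i => hb.exists_mode_evolution hS i (x i) (y i)
  have hnorm : ∀ t, 0 ≤ t → ‖S.toFun t (∑ i ∈ F, hb.modeVec i (x i) (y i))‖ ^ 2 =
      ∑ i ∈ F, (lam i * ‖u i t‖ ^ 2 + ‖v i t‖ ^ 2) := by
    intro t ht
    rw [← hb.norm_sum_modeVec_sq F (fun i => u i t) (fun i => v i t),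
      ← (phaseEmbed A).norm_map, ← (phaseEmbed A).norm_map (∑ i ∈ F, _), map_sum, map_sum, map_sum]
    simp only [huv _ t ht]
  refine ⟨fun t ht => ?_, fun hf => ?_⟩
  · refine (pow_le_pow_iff_left₀ (norm_nonneg _) (norm_nonneg _) two_ne_zero).1 ?_
    rw [hnorm t ht, hb.norm_sum_modeVec_sq]
    refine Finset.sum_le_sum fun i _ => ?_
    rw [← hu0 i, ← hv0 i, energy_eq_re_add_im, energy_eq_re_add_im]
    exact add_le_add ((hre i).energy_antitone (hf0 i) ht) ((him i).energy_antitone (hf0 i) ht)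
  · have h : Tendsto (fun t => ‖S.toFun t (∑ i ∈ F, hb.modeVec i (x i) (y i))‖ ^ 2) atTop
        (𝓝 0) := by
      have h1 : Tendsto (fun t => ∑ i ∈ F, (lam i * ‖u i t‖ ^ 2 + ‖v i t‖ ^ 2)) atTop
          (𝓝 (∑ i ∈ F, 0)) := by
        refine tendsto_finsetSum _ fun i _ => ?_
        simp only [energy_eq_re_add_im]
        rw [← add_zero (0 : ℝ)]
        exact ((hre i).tendsto_energy (hb.pos i) (hf i)).add
          ((him i).tendsto_energy (hb.pos i) (hf i))
      rw [Finset.sum_const_zero] at h1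
      refine h1.congr' ?_
      filter_upwards [eventually_ge_atTop 0] with t ht
      exact (hnorm t ht).symm
    have h2 := h.sqrt
    rw [Real.sqrt_zero] at h2
    exact h2.congr fun t => Real.sqrt_sq (norm_nonneg _)

include hb hS in
theorem norm_apply_le (hf0 : ∀ i, 0 ≤ f (lam i)) {t : ℝ} (ht : 0 ≤ t) (z : PhaseSpace A) :
    ‖S.toFun t z‖ ≤ ‖z‖ := by
  refine closure_minimal (t := {z | ‖S.toFun t z‖ ≤ ‖z‖}) ?_
    (isClosed_le (S.toFun t).continuous.norm continuous_norm) (hb.dense_sum_modeVec z)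
  rintro _ ⟨F, x, y, rfl⟩
  exact (hb.exists_energy_sum hS hf0 F x y).1 t ht

include hb hS in
-- Approximate by a finite sum of modes, which decays; contractivity keeps the error small for all
-- times.
theorem isStable (hf : ∀ i, 0 < f (lam i)) : S.IsStable := by
  intro z
  rw [Metric.tendsto_nhds]
  intro ε hε
  obtain ⟨w, ⟨F, x, y, rfl⟩, hw⟩ := Metric.mem_closure_iff.1 (hb.dense_sum_modeVec z) (ε / 2)
    (half_pos hε)
  have h := Metric.tendsto_nhds.1 ((hb.exists_energy_sum hS (fun i => (hf i).le) F x y).2 hf)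
    (ε / 2) (half_pos hε)
  filter_upwards [h, eventually_ge_atTop 0] with t h1 ht
  have h2 := hb.norm_apply_le hS (fun i => (hf i).le) ht (z - ∑ i ∈ F, hb.modeVec i (x i) (y i))
  rw [dist_eq_norm] at hw
  rw [dist_zero_right, norm_norm] at h1 ⊢
  rw [map_sub] at h2
  have h3 := norm_sub_norm_le (S.toFun t z) (S.toFun t (∑ i ∈ F, hb.modeVec i (x i) (y i)))
  linarith

include hb hS in
-- An undamped mode started at `(0, b i)` keeps energy `1` forever.
theorem ne_zero_of_isStable (hst : S.IsStable) (i : ι) : f (lam i) ≠ 0 := by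
  intro hf
  obtain ⟨u, v, huv, hre, him, hu0, hv0⟩ := hb.exists_mode_evolution hS i 0 1
  rw [hf] at hre him
  have hconst : ∀ {a b : ℝ → ℝ}, IsOscillator (lam i) 0 a b → ∀ t,
      lam i * a t ^ 2 + b t ^ 2 = lam i * a 0 ^ 2 + b 0 ^ 2 := fun h t =>
    is_const_of_deriv_eq_zero (fun s => (h.hasDerivAt_energy s).differentiableAt)
      (fun s => by rw [(h.hasDerivAt_energy s).deriv]; ring) t 0
  have hnorm : ∀ t, 0 ≤ t → ‖S.toFun t (hb.modeVec i 0 1)‖ ^ 2 = 1 := by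
    intro t ht
    have h := hb.norm_sum_modeVec_sq {i} (fun _ => u t) (fun _ => v t)
    rw [Finset.sum_singleton, Finset.sum_singleton] at h
    rw [← (phaseEmbed A).norm_map, huv t ht, (phaseEmbed A).norm_map, h, energy_eq_re_add_im,
      hconst hre, hconst him, ← energy_eq_re_add_im, hu0, hv0]
    simp
  have h1 := (hst (hb.modeVec i 0 1)).pow 2
  have h2 : Tendsto (fun _ : ℝ => (1 : ℝ)) atTop (𝓝 (0 ^ 2)) := by
    refine h1.congr' ?_
    filter_upwards [eventually_ge_atTop 0] with t ht
    exact hnorm t ht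
  have h3 := tendsto_nhds_unique h2 tendsto_const_nhds
  norm_num at h3

end IsEigenbasis

end Main

end DampedWave

theorem mainTheorem9 {H : Type*} [NormedAddCommGroup H] [InnerProductSpace ℂ H] [CompleteSpace H]
    [TopologicalSpace.SeparableSpace H]
    (A : H →ₗ.[ℂ] H) (hA : DampedWave.IsStrictlyPositiveSelfAdjoint A)
    (f : ℝ → ℝ) (hf : ContinuousOn f (DampedWave.realSpectrum A))
    (hf0 : ∀ s ∈ DampedWave.realSpectrum A, 0 ≤ f s)
    (S : DampedWave.C0Semigroup (DampedWave.PhaseSpace A))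
    (hS : S.generatorGraph = DampedWave.waveGraph A f)
    (hcomp : DampedWave.HasCompactInverse A) :
    S.IsStable ↔ DampedWave.zeroSet A f = ∅ := by
  obtain ⟨ι, b, lam, hb⟩ := DampedWave.exists_isEigenbasis hA hcomp
  have := b.orthonormal.countable
  have hmem : ∀ i, lam i ∈ DampedWave.realSpectrum A := fun i =>
    hb.realSpectrum_eq ▸ Set.mem_range_self i
  constructor
  · intro hst
    rw [Set.eq_empty_iff_forall_notMem]
    rintro s ⟨hs, hs0⟩
    rw [hb.realSpectrum_eq] at hs
    obtain ⟨i, rfl⟩ := hs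
    exact hb.ne_zero_of_isStable hS hst i hs0
  · intro hz
    refine hb.isStable hS fun i => (hf0 _ (hmem i)).lt_of_ne fun h0 => ?_
    exact Set.eq_empty_iff_forall_notMem.1 hz (lam i) ⟨hmem i, h0.symm⟩
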